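/- Let $\Phi^{-1}\colon\mathbb S^2\setminus\{\mathbf e_3\}\to\mathbb R^2$, $\Phi^{-1}(\xi)=\frac{1}{1-\xi_3}(\xi_1,\xi_2)$, be the stereographic projection from the north pole $\mathbf e_3=(0,0,1)$ of the unit sphere $\mathbb S^2\subset\mathbb R^3$, with $\mathbf e_3$ corresponding to $\infty$. Let $\mathcal H(\mathbb R^2;\mathbb S^2)$ be the set of maps $\boldsymbol m=(m_1,m_2,m_3)\colon\mathbb R^2\to\mathbb R^3$ with $|\boldsymbol m|=1$ almost everywhere, whose components lie in $W^{1,1}_{\rm loc}(\mathbb R^2)$ and satisfy $\int_{\mathbb R^2}|\nabla \boldsymbol m|^2\,dx<\infty$. Let $\boldsymbol m\in\mathcal H(\mathbb R^2;\mathbb S^2)$, and suppose that $1-m_3^2$ or $1-m_3$ is integrable on $\mathbb R^2$. Then the map $w=\boldsymbol m\circ\Phi^{-1}$, which is defined almost everywhere on $\mathbb S^2$, belongs to $W^{1,2}(\mathbb S^2;\mathbb S^2)$, that is, $|w|=1$ almost everywhere and the components of $w$ are in $L^2(\mathbb S^2)$ with weak tangential gradient in $L^2(\mathbb S^2)$.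 Moreover $\mathbf e_3$ is a Lebesgue point of $w$, that is, there is $a\in\mathbb R^3$ such that the mean value of $|w-a|$, with respect to the surface measure, over the ball $\{\xi\in\mathbb S^2:|\xi-\mathbf e_3|<r\}$ tends to $0$ as $r\to0^+$. -/

import Mathlib

open MeasureTheory Filter Topology
open scoped ContDiff

namespace LebesguePointAtInfinity

noncomputable section

/-- The Euclidean plane `ℝ²`. -/
abbrev Plane : Type := EuclideanSpace ℝ (Fin 2)

/-- Euclidean three-space `ℝ³`. -/
abbrev Space : Type := EuclideanSpace ℝ (Fin 3)

/-- The unit sphere `𝕊²` of `ℝ³`. -/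
abbrev Sphere : Type := Metric.sphere (0 : Space) 1

/-- The surface measure of `𝕊²` induced by Lebesgue measure on `ℝ³` through polar coordinates
(total mass `4π`). -/
abbrev surface : Measure Sphere := (volume : Measure Space).toSphere

/-- The north pole `e₃ = (0, 0, 1)`. -/
def northPole : Sphere := ⟨EuclideanSpace.single 2 1, by simp⟩

/-- The stereographic projection `Φ⁻¹(ξ) = (ξ₁, ξ₂) / (1 - ξ₃)`, for `ξ ≠ e₃`. It sends `e₃` to
`∞`; the value that the formula takes at this one point, a null set, plays no role. -/
def stereo (ξ : Sphere) : Plane :=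
  !₂[(ξ : Space) 0 / (1 - (ξ : Space) 2), (ξ : Space) 1 / (1 - (ξ : Space) 2)]

/-- `G` is the weak gradient of the function `v ∈ L¹_loc(ℝ²)`, and `G ∈ L¹_loc(ℝ²; ℝ²)`. -/
structure HasWeakGradient (v : Plane → ℝ) (G : Plane → Plane) : Prop where
  locallyIntegrable : LocallyIntegrable v
  locallyIntegrable_gradient : LocallyIntegrable G
  integral_eq : ∀ φ : Plane → ℝ, ContDiff ℝ ∞ φ → HasCompactSupport φ → ∀ i : Fin 2,
    ∫ x, v x * fderiv ℝ φ x (EuclideanSpace.single i 1) = - ∫ x, G x i * φ x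

/-- The homogeneous Sobolev space `ℋ(ℝ²) = {v ∈ W^{1,1}_loc(ℝ²) : ∫ |∇v|² < ∞}`. -/
def MemHomSobolev (v : Plane → ℝ) : Prop :=
  ∃ G : Plane → Plane, HasWeakGradient v G ∧ MemLp G 2

/-- The space `ℋ(ℝ²; 𝕊²)`: the components belong to `ℋ(ℝ²)`, and the values to `𝕊²` almost
everywhere. Since such maps are bounded, `W^{1,1}_loc` may be replaced by `H¹_loc` here. -/
def MemHomSobolevSphere (m : Plane → Space) : Prop :=
  (∀ i : Fin 3, MemHomSobolev fun x => m x i) ∧ ∀ᵐ x, ‖m x‖ = 1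

/-- The tangential divergence `div_T X(ξ) = tr DX(ξ) - ⟨DX(ξ) ξ, ξ⟩` at a point `ξ` of `𝕊²`. -/
def tangentialDiv (X : Space → Space) (ξ : Sphere) : ℝ :=
  (∑ i : Fin 3, fderiv ℝ X ξ (EuclideanSpace.single i 1) i) -
    inner ℝ (fderiv ℝ X ξ (ξ : Space)) (ξ : Space)

/-- `G` is the weak tangential gradient of `u : 𝕊² → ℝ`: it is a tangential vector field, and
`∫ u div_T X = - ∫ ⟨G, X⟩` for all smooth tangential vector fields `X` on `𝕊²`. -/
structure HasWeakTangentialGradient (u : Sphere → ℝ) (G : Sphere → Space) : Prop where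
  integrable : Integrable u surface
  integrable_gradient : Integrable G surface
  tangential : ∀ᵐ ξ ∂surface, inner ℝ (G ξ) (ξ : Space) = 0
  integral_eq : ∀ X : Space → Space, ContDiff ℝ ∞ X →
    (∀ ξ : Sphere, inner ℝ (X ξ) (ξ : Space) = 0) →
    ∫ ξ, u ξ * tangentialDiv X ξ ∂surface = - ∫ ξ, inner ℝ (G ξ) (X ξ) ∂surface

/-- The Sobolev space `W^{1,2}(𝕊²)`. -/
def MemSobolev (u : Sphere → ℝ) : Prop :=
  MemLp u 2 surface ∧
    ∃ G : Sphere → Space, HasWeakTangentialGradient u G ∧ MemLp G 2 surface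

/-- The Sobolev space `W^{1,2}(𝕊²; 𝕊²)`. -/
def MemSobolevSphere (w : Sphere → Space) : Prop :=
  (∀ i : Fin 3, MemSobolev fun ξ => w ξ i) ∧ ∀ᵐ ξ ∂surface, ‖w ξ‖ = 1

/-- `p` is a Lebesgue point of `w`: the map `w` is integrable near `p` and, for some value `a`,
the means of `|w - a|` over the balls centred at `p` tend to `0` with the radius. The value of `w`
at `p` itself is disregarded, as `w` is only determined almost everywhere. -/
def IsLebesguePoint (w : Sphere → Space) (p : Sphere) : Prop :=
  IntegrableAtFilter w (𝓝 p) surface ∧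
    ∃ a : Space, Tendsto (fun r : ℝ => ⨍ ξ in Metric.ball p r, ‖w ξ - a‖ ∂surface)
      (𝓝[>] 0) (𝓝 0)

end

end LebesguePointAtInfinity

namespace LebesguePointAtInfinity

noncomputable section

/-! The Sobolev half is conformal invariance in two dimensions. In the stereographic chart Φ the
surface measure is λ² dx with λ = 2 / (1 + |x|²) (`surface_eq_map`), while tangential gradients
scale by λ⁻¹, so the Dirichlet energy is unchanged (`memLp_sphereGradient`). A tangential test field
X pulls back to the planar field V_j = ⟨∂_jΦ, X ∘ Φ⟩ with div V = λ² div_T X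
(`divergence_pullbackField`). V need not have compact support, but it is O(λ), so cut-offs can be
removed in the limit and the pole contributes nothing (`HasWeakGradient.integral_mul_divergence`).

For the Lebesgue point it suffices that 1 - s m₃ is integrable for a sign s = ±1. Indeed |m - s e₃|²
= 2 (1 - s m₃), and λ < r² / 2 on the r-ball about the pole; hence the integral of |w - s e₃|² over
that ball is O(r⁴), which is small compared with its area (`isLebesguePoint_northPole`).

If only 1 - m₃² is known to be integrable, the sign has to be found (`HasWeakGradient.exists_sign`).
As in the Modica–Mortola argument, F = m₃ - m₃³/3 has gradient (1 - m₃²) ∇m₃, which is integrable.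
Along almost every line parallel to an axis the oscillation of F is therefore at most an integrable
function, a(x₁) or b(x₂), of the transversal coordinate. Joining points by two axis-parallel
segments and sending one of them to places where a and b are small gives a constant c with |F - c| ≤
a(x₁) and |F - c| ≤ b(x₂), so (F - c)² ≤ a(x₁) b(x₂) is integrable. Since the plane has infinite
measure and 1 - m₃² is integrable, c must be F(±1) = ±2/3, and this selects s. -/

/-! ### Stereographic coordinates -/

/-- The conformal factor `2 / (1 + |x|²)` of the stereographic parametrization. -/
def conformalFactor (x : Plane) : ℝ := 2 / (1 + (x 0 ^ 2 + x 1 ^ 2))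

/-- The inverse of the stereographic projection, as a map into `ℝ³`. -/
def invStereoVal (x : Plane) : Space :=
  !₂[2 * x 0 / (1 + (x 0 ^ 2 + x 1 ^ 2)), 2 * x 1 / (1 + (x 0 ^ 2 + x 1 ^ 2)),
    (x 0 ^ 2 + x 1 ^ 2 - 1) / (1 + (x 0 ^ 2 + x 1 ^ 2))]

lemma one_add_sq_add_sq_pos (a b : ℝ) : 0 < 1 + (a ^ 2 + b ^ 2) := by positivity

lemma conformalFactor_pos (x : Plane) : 0 < conformalFactor x := by
  unfold conformalFactor; positivity

lemma norm_invStereoVal (x : Plane) : ‖invStereoVal x‖ = 1 := by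
  have h := (one_add_sq_add_sq_pos (x 0) (x 1)).ne'
  rw [EuclideanSpace.norm_eq, Real.sqrt_eq_one]
  simp only [invStereoVal, Fin.sum_univ_three, Real.norm_eq_abs, sq_abs]
  simp
  field_simp
  ring

/-- The inverse of the stereographic projection. -/
def invStereo (x : Plane) : Sphere := ⟨invStereoVal x, by simp [norm_invStereoVal]⟩

lemma contDiff_invStereoVal : ContDiff ℝ ∞ invStereoVal := by
  have h (x : Plane) := (one_add_sq_add_sq_pos (x 0) (x 1)).ne'
  rw [contDiff_euclidean]
  intro i
  fin_cases i <;> simp [invStereoVal] <;> fun_prop (disch := exact h)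

lemma continuous_invStereo : Continuous invStereo :=
  contDiff_invStereoVal.continuous.subtype_mk _

lemma stereo_invStereo (x : Plane) : stereo (invStereo x) = x := by
  have h := (one_add_sq_add_sq_pos (x 0) (x 1)).ne'
  ext i
  fin_cases i <;> simp [stereo, invStereo, invStereoVal] <;> field_simp <;> ring

lemma sum_sq_sphere (ξ : Sphere) :
    (ξ : Space) 0 ^ 2 + (ξ : Space) 1 ^ 2 + (ξ : Space) 2 ^ 2 = 1 := by
  have h : ‖(ξ : Space)‖ = 1 := by simp
  rw [EuclideanSpace.norm_eq, Real.sqrt_eq_one] at h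
  simpa [Fin.sum_univ_three] using h

lemma invStereo_stereo {ξ : Sphere} (hξ : (ξ : Space) 2 ≠ 1) : invStereo (stereo ξ) = ξ := by
  have hs := sum_sq_sphere ξ
  have h1 : 1 - (ξ : Space) 2 ≠ 0 := sub_ne_zero.2 hξ.symm
  have hD : 1 + (((ξ : Space) 0 / (1 - (ξ : Space) 2)) ^ 2 +
      ((ξ : Space) 1 / (1 - (ξ : Space) 2)) ^ 2) = 2 / (1 - (ξ : Space) 2) := by
    field_simp
    linear_combination hs
  have hD' : ((ξ : Space) 0 / (1 - (ξ : Space) 2)) ^ 2 +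
      ((ξ : Space) 1 / (1 - (ξ : Space) 2)) ^ 2 = 2 / (1 - (ξ : Space) 2) - 1 := by
    linarith
  ext i
  fin_cases i <;> simp [stereo, invStereo, invStereoVal, hD'] <;> field_simp
  ring

lemma injective_invStereo : Function.Injective invStereo :=
  Function.LeftInverse.injective stereo_invStereo

lemma measurableEmbedding_invStereo : MeasurableEmbedding invStereo :=
  continuous_invStereo.measurableEmbedding injective_invStereo

lemma ne_one_of_ne_northPole {ξ : Sphere} (h : ξ ≠ northPole) : (ξ : Space) 2 ≠ 1 := by
  intro h1
  have hs := sum_sq_sphere ξ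
  rw [h1] at hs
  have h0 : (ξ : Space) 0 = 0 := by nlinarith [sq_nonneg ((ξ : Space) 0), sq_nonneg ((ξ : Space) 1)]
  have h2 : (ξ : Space) 1 = 0 := by nlinarith [sq_nonneg ((ξ : Space) 0), sq_nonneg ((ξ : Space) 1)]
  apply h
  ext i
  fin_cases i <;> simp [northPole, h0, h1, h2]

/-! ### The surface measure in the stereographic chart -/

/-- The parametrization `(r, y) ↦ r Φ(y)` of the punctured space. -/
def polarMap (z : Fin 3 → ℝ) : Fin 3 → ℝ :=
  ![z 0 * (2 * z 1) * (1 + (z 1 ^ 2 + z 2 ^ 2))⁻¹, z 0 * (2 * z 2) * (1 + (z 1 ^ 2 + z 2 ^ 2))⁻¹,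
    z 0 * (z 1 ^ 2 + z 2 ^ 2 - 1) * (1 + (z 1 ^ 2 + z 2 ^ 2))⁻¹]

/-- The Jacobian matrix of `polarMap`. -/
def polarJacobian (z : Fin 3 → ℝ) : Matrix (Fin 3) (Fin 3) ℝ :=
  let d := (1 + (z 1 ^ 2 + z 2 ^ 2))
  !![2 * z 1 / d, z 0 * (2 / d - 4 * z 1 ^ 2 / d ^ 2), z 0 * (- 4 * z 1 * z 2 / d ^ 2);
    2 * z 2 / d, z 0 * (- 4 * z 1 * z 2 / d ^ 2), z 0 * (2 / d - 4 * z 2 ^ 2 / d ^ 2);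
    (z 1 ^ 2 + z 2 ^ 2 - 1) / d, z 0 * (4 * z 1 / d ^ 2), z 0 * (4 * z 2 / d ^ 2)]

/-- The Jacobian splits into a radial factor and a factor of the chart, so the volume of a cone
separates by Tonelli. The minus sign is only the orientation of the chart. -/
lemma det_polarJacobian (z : Fin 3 → ℝ) :
    (polarJacobian z).det = -(z 0 ^ 2 * (2 / (1 + (z 1 ^ 2 + z 2 ^ 2))) ^ 2) := by
  have h := (one_add_sq_add_sq_pos (z 1) (z 2)).ne'
  simp [polarJacobian, Matrix.det_fin_three]
  field_simp
  ring

lemma hasFDerivAt_polarMap (z : Fin 3 → ℝ) :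
    HasFDerivAt polarMap (LinearMap.toContinuousLinearMap (Matrix.toLin' (polarJacobian z))) z := by
  have h := (one_add_sq_add_sq_pos (z 1) (z 2)).ne'
  have hp (i : Fin 3) : HasFDerivAt (fun z : Fin 3 → ℝ => z i)
    (ContinuousLinearMap.proj (R := ℝ) (φ := fun _ : Fin 3 => ℝ) i) z := hasFDerivAt_apply i z
  have hs := ((hp 1).pow 2).add ((hp 2).pow 2)
  have hD := (hasDerivAt_inv h).comp_hasFDerivAt z (hs.const_add 1)
  rw [hasFDerivAt_pi']
  intro i
  fin_cases i
  · refine ((((hp 0).mul ((hp 1).const_mul 2)).mul hD).congr_fderiv ?_)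
    ext v
    simp [polarJacobian, Matrix.toLin'_apply, dotProduct, Fin.sum_univ_three]
    field_simp
    ring
  · refine ((((hp 0).mul ((hp 2).const_mul 2)).mul hD).congr_fderiv ?_)
    ext v
    simp [polarJacobian, Matrix.toLin'_apply, dotProduct, Fin.sum_univ_three]
    field_simp
    ring
  · refine ((((hp 0).mul (hs.sub_const 1)).mul hD).congr_fderiv ?_)
    ext v
    simp [polarJacobian, Matrix.toLin'_apply, dotProduct, Fin.sum_univ_three]
    field_simp
    ring

lemma polarMap_eq (z : Fin 3 → ℝ) :
    polarMap z = WithLp.ofLp (z 0 • (invStereo !₂[z 1, z 2] : Space)) := by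
  ext i
  fin_cases i <;> simp [polarMap, invStereo, invStereoVal] <;> ring

lemma injOn_polarMap : Set.InjOn polarMap {z | 0 < z 0} := by
  intro z hz y hy h
  rw [polarMap_eq, polarMap_eq] at h
  have h' := WithLp.ofLp_injective 2 h
  have hn := congrArg norm h'
  simp only [norm_smul, Real.norm_eq_abs, norm_eq_of_mem_sphere, mul_one] at hn
  rw [abs_of_pos hz, abs_of_pos hy] at hn
  rw [hn] at h'
  have h2 := injective_invStereo (Subtype.ext (smul_right_injective Space (ne_of_gt hy) h'))
  ext i
  fin_cases i
  · exact hn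
  · simpa using congrArg (fun v : Plane => v 0) h2
  · simpa using congrArg (fun v : Plane => v 1) h2

lemma measurable_conformalFactor : Measurable conformalFactor := by
  unfold conformalFactor
  fun_prop

lemma lintegral_Ioo_sq : ∫⁻ r in Set.Ioo (0 : ℝ) 1, ENNReal.ofReal (r ^ 2) = 3⁻¹ := by
  rw [← ofReal_integral_eq_lintegral_ofReal]
  · rw [← integral_Ioc_eq_integral_Ioo, ← intervalIntegral.integral_of_le zero_le_one, integral_pow]
    norm_num
    rw [ENNReal.ofReal_div_of_pos (by norm_num)]
    simp
  · exact ((continuous_pow 2).integrableOn_Icc (a := (0:ℝ)) (b := 1)).mono_set Set.Ioo_subset_Icc_self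
  · exact Eventually.of_forall fun r => sq_nonneg r

/-- The part of `(0, 1) × ℝ²` that `polarMap` sends to the cone over `s`. -/
def polarDomain (s : Set Sphere) : Set (Fin 3 → ℝ) :=
  {z | z 0 ∈ Set.Ioo (0 : ℝ) 1 ∧ invStereo !₂[z 1, z 2] ∈ s}

lemma measurableSet_polarDomain {s : Set Sphere} (hs : MeasurableSet s) :
    MeasurableSet (polarDomain s) := by
  have h1 : Measurable fun z : Fin 3 → ℝ => z 0 := measurable_pi_apply 0
  have h2 : Measurable fun z : Fin 3 → ℝ => invStereo !₂[z 1, z 2] := by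
    refine continuous_invStereo.measurable.comp ?_
    refine Continuous.measurable ?_
    fun_prop
  exact (h1 measurableSet_Ioo).inter (h2 hs)

/-- Change of variables for `polarMap`. The factor 3 is the dimension in the definition of
`toSphere`; it cancels the radial integral of r² over (0, 1). -/
lemma volume_polarMap_image {s : Set Sphere} (hs : MeasurableSet s) :
    3 * volume (polarMap '' polarDomain s) =
      ∫⁻ x in invStereo ⁻¹' s, ENNReal.ofReal (conformalFactor x ^ 2) := by
  rw [← lintegral_abs_det_fderiv_eq_addHaar_image volume (measurableSet_polarDomain hs)
    (fun z _ => (hasFDerivAt_polarMap z).hasFDerivWithinAt)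
    (injOn_polarMap.mono fun z hz => hz.1.1)]
  let e := MeasurableEquiv.piFinSuccAbove (fun _ : Fin 3 => ℝ) 0
  have he : MeasurePreserving e := volume_preserving_piFinSuccAbove (fun _ : Fin 3 => ℝ) 0
  let F : ℝ × (Fin 2 → ℝ) → ENNReal := fun p =>
    ENNReal.ofReal (p.1 ^ 2) * ENNReal.ofReal (conformalFactor (WithLp.toLp 2 p.2) ^ 2)
  have hdom : polarDomain s =
      e ⁻¹' (Set.Ioo (0 : ℝ) 1 ×ˢ ((fun y => invStereo (WithLp.toLp 2 y)) ⁻¹' s)) := by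
    ext z
    have : (!₂[z 1, z 2] : Plane) = WithLp.toLp 2 (e z).2 := by
      ext i; fin_cases i <;> rfl
    simp only [polarDomain, Set.mem_ofPred_eq, Set.mem_preimage, Set.mem_prod, this]
    rfl
  have hdet (z : Fin 3 → ℝ) : ENNReal.ofReal |(LinearMap.toContinuousLinearMap
      (Matrix.toLin' (polarJacobian z))).det| = F (e z) := by
    rw [ContinuousLinearMap.det]
    simp only [LinearMap.coe_toContinuousLinearMap, LinearMap.det_toLin', det_polarJacobian]
    rw [abs_neg, abs_of_nonneg (by positivity), ENNReal.ofReal_mul (by positivity)]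
    rfl
  simp_rw [hdet]
  rw [hdom, he.setLIntegral_comp_preimage_emb e.measurableEmbedding]
  rw [Measure.volume_eq_prod, ← Measure.prod_restrict]
  have hm := measurable_conformalFactor
  rw [lintegral_prod_mul (f := fun r : ℝ => ENNReal.ofReal (r ^ 2))
    (g := fun y : Fin 2 → ℝ => ENNReal.ofReal (conformalFactor (WithLp.toLp 2 y) ^ 2))
    (by fun_prop) (by fun_prop), lintegral_Ioo_sq, ← mul_assoc,
    ENNReal.mul_inv_cancel (by simp) (by simp), one_mul]
  have := (PiLp.volume_preserving_toLp (Fin 2)).setLIntegral_comp_preimage_emb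
    (MeasurableEquiv.toLp 2 (Fin 2 → ℝ)).measurableEmbedding
    (fun x : Plane => ENNReal.ofReal (conformalFactor x ^ 2)) (invStereo ⁻¹' s)
  exact this

lemma volume_coordinate_zero : volume {x : Space | x 0 = 0} = 0 := by
  have := (PiLp.volume_preserving_ofLp (Fin 3)).measure_preimage_emb
    (MeasurableEquiv.toLp 2 (Fin 3 → ℝ)).symm.measurableEmbedding {y | y 0 = 0}
  have h2 : volume {y : Fin 3 → ℝ | y 0 = 0} = 0 := Measure.pi_hyperplane _ 0 0
  rw [h2] at this
  exact this

/-- The chart misses only the north pole. The ray through it lies in the null plane where the first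
coordinate vanishes. -/
lemma volume_cone (s : Set Sphere) :
    volume (Set.image2 (· • ·) (Set.Ioo (0 : ℝ) 1) ((↑) '' s : Set Space)) =
      volume (polarMap '' polarDomain s) := by
  have hv := (PiLp.volume_preserving_ofLp (Fin 3)).measure_preimage_emb
    (MeasurableEquiv.toLp 2 (Fin 3 → ℝ)).symm.measurableEmbedding (polarMap '' polarDomain s)
  rw [← hv]
  apply le_antisymm
  · refine (measure_mono (t := (WithLp.ofLp ⁻¹' (polarMap '' polarDomain s)) ∪
      {x : Space | x 0 = 0}) ?_).trans ((measure_union_le _ _).trans ?_)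
    · rintro _ ⟨r, hr, _, ⟨ξ, hξ, rfl⟩, rfl⟩
      by_cases h : ξ = northPole
      · right
        simp [h, northPole]
      · left
        refine ⟨![r, stereo ξ 0, stereo ξ 1], ⟨hr, ?_⟩, ?_⟩
        · have : (!₂[stereo ξ 0, stereo ξ 1] : Plane) = stereo ξ := by
            ext i; fin_cases i <;> rfl
          simpa [this, invStereo_stereo (ne_one_of_ne_northPole h)] using hξ
        · rw [polarMap_eq]
          have : (!₂[stereo ξ 0, stereo ξ 1] : Plane) = stereo ξ := by
            ext i; fin_cases i <;> rfl
          simp [this, invStereo_stereo (ne_one_of_ne_northPole h)]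
    · rw [volume_coordinate_zero, add_zero]
  · apply measure_mono
    rintro x ⟨z, hz, hx⟩
    rw [polarMap_eq] at hx
    exact ⟨z 0, hz.1, _, ⟨_, hz.2, rfl⟩, WithLp.ofLp_injective 2 hx⟩

/-- In the stereographic chart, the surface measure has density `(2 / (1 + |x|²))²`. -/
theorem surface_eq_map : surface =
    (volume.withDensity fun x => ENNReal.ofReal (conformalFactor x ^ 2)).map invStereo := by
  ext s hs
  rw [Measure.toSphere_apply' _ hs, Measure.map_apply continuous_invStereo.measurable hs,
    withDensity_apply _ (continuous_invStereo.measurable hs), ← volume_polarMap_image hs]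
  congr 1
  · simp
  · exact volume_cone s

/-- The density is positive everywhere, so null sets correspond in both directions. -/
lemma ae_surface_iff {p : Sphere → Prop} :
    (∀ᵐ ξ ∂surface, p ξ) ↔ ∀ᵐ x, p (invStereo x) := by
  have hm := measurable_conformalFactor
  rw [surface_eq_map, measurableEmbedding_invStereo.ae_map_iff, ae_withDensity_iff (by fun_prop)]
  refine eventually_congr (Eventually.of_forall fun x => ?_)
  have := conformalFactor_pos x
  simp [this.ne']

lemma ae_surface_stereo {p : Plane → Prop} (h : ∀ᵐ x, p x) : ∀ᵐ ξ ∂surface, p (stereo ξ) := by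
  rw [ae_surface_iff]
  simpa only [stereo_invStereo] using h

lemma integral_surface {F : Type*} [NormedAddCommGroup F] [NormedSpace ℝ F] (f : Sphere → F) :
    ∫ ξ, f ξ ∂surface = ∫ x, conformalFactor x ^ 2 • f (invStereo x) := by
  have hm := measurable_conformalFactor
  rw [surface_eq_map, measurableEmbedding_invStereo.integral_map,
    integral_withDensity_eq_integral_toReal_smul (by fun_prop) (by simp)]
  simp [ENNReal.toReal_ofReal, sq_nonneg]

lemma integrable_surface_iff {F : Type*} [NormedAddCommGroup F] [NormedSpace ℝ F]
    (f : Sphere → F) : Integrable f surface ↔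
      Integrable fun x => conformalFactor x ^ 2 • f (invStereo x) := by
  have hm := measurable_conformalFactor
  rw [surface_eq_map, measurableEmbedding_invStereo.integrable_map_iff,
    integrable_withDensity_iff_integrable_smul' (by fun_prop) (by simp)]
  simp [ENNReal.toReal_ofReal, sq_nonneg]

lemma aestronglyMeasurable_surface {F : Type*} [NormedAddCommGroup F] {f : Sphere → F}
    (hf : AEStronglyMeasurable (f ∘ invStereo)) : AEStronglyMeasurable f surface := by
  rw [surface_eq_map, measurableEmbedding_invStereo.aestronglyMeasurable_map_iff]
  exact hf.mono_ac (withDensity_absolutelyContinuous _ _)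

lemma integrable_conformalFactor_sq : Integrable fun x => conformalFactor x ^ 2 := by
  simpa using (integrable_surface_iff fun _ => (1 : ℝ)).1 (integrable_const 1)

/-! ### The conformal frame and pulled-back vector fields -/

/-- The partial derivatives of the inverse stereographic projection. -/
def tangentFrame (j : Fin 2) (x : Plane) : Space :=
  ![!₂[conformalFactor x - conformalFactor x ^ 2 * x 0 ^ 2, - conformalFactor x ^ 2 * x 0 * x 1,
      conformalFactor x ^ 2 * x 0],
    !₂[- conformalFactor x ^ 2 * x 0 * x 1, conformalFactor x - conformalFactor x ^ 2 * x 1 ^ 2,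
      conformalFactor x ^ 2 * x 1]] j

/-- The one relation between λ and the coordinates. The frame identities below are polynomial
identities modulo it, and the `linear_combination` coefficients are the cofactors. -/
lemma conformalFactor_mul (x : Plane) : conformalFactor x * (1 + (x 0 ^ 2 + x 1 ^ 2)) = 2 := by
  have h := (one_add_sq_add_sq_pos (x 0) (x 1)).ne'
  unfold conformalFactor; field_simp

lemma invStereoVal_eq (x : Plane) :
    invStereoVal x = !₂[conformalFactor x * x 0, conformalFactor x * x 1, 1 - conformalFactor x] := by
  have h := (one_add_sq_add_sq_pos (x 0) (x 1)).ne'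
  ext i
  fin_cases i <;> simp [invStereoVal, conformalFactor] <;> field_simp
  ring

lemma inner_space (u v : Space) : inner ℝ u v = u 0 * v 0 + u 1 * v 1 + u 2 * v 2 := by
  simp [PiLp.inner_apply, Fin.sum_univ_three]; ring

lemma inner_tangentFrame_invStereo (j : Fin 2) (x : Plane) :
    inner ℝ (tangentFrame j x) (invStereo x : Space) = 0 := by
  have h := conformalFactor_mul x
  simp only [invStereo, invStereoVal_eq, inner_space]
  fin_cases j <;> simp [tangentFrame]
  · linear_combination (- conformalFactor x ^ 2 * x 0) * h
  · linear_combination (- conformalFactor x ^ 2 * x 1) * h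

lemma inner_tangentFrame_zero_one (x : Plane) :
    inner ℝ (tangentFrame 0 x) (tangentFrame 1 x) = 0 := by
  have h := conformalFactor_mul x
  simp [tangentFrame, inner_space]
  linear_combination (conformalFactor x ^ 3 * x 0 * x 1) * h

lemma norm_sq_tangentFrame (j : Fin 2) (x : Plane) :
    ‖tangentFrame j x‖ ^ 2 = conformalFactor x ^ 2 := by
  have h := conformalFactor_mul x
  rw [← real_inner_self_eq_norm_sq, inner_space]
  fin_cases j <;> simp [tangentFrame]
  · linear_combination (conformalFactor x ^ 3 * x 0 ^ 2) * h
  · linear_combination (conformalFactor x ^ 3 * x 1 ^ 2) * h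

lemma norm_tangentFrame (j : Fin 2) (x : Plane) : ‖tangentFrame j x‖ = conformalFactor x := by
  have := norm_sq_tangentFrame j x
  rwa [sq_eq_sq₀ (norm_nonneg _) (conformalFactor_pos x).le] at this

lemma contDiff_conformalFactor : ContDiff ℝ ∞ conformalFactor := by
  have h (x : Plane) := (one_add_sq_add_sq_pos (x 0) (x 1)).ne'
  unfold conformalFactor
  fun_prop (disch := exact h)

lemma contDiff_tangentFrame (j : Fin 2) : ContDiff ℝ ∞ (tangentFrame j) := by
  have h := contDiff_conformalFactor
  rw [contDiff_euclidean]
  intro i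
  fin_cases j <;> fin_cases i <;> simp [tangentFrame] <;> fun_prop

lemma hasDerivAt_line_apply (x : Plane) (j k : Fin 2) :
    HasDerivAt (fun t : ℝ => (x + t • EuclideanSpace.single j (1 : ℝ)) k)
      (if k = j then 1 else 0) 0 := by
  have : (fun t : ℝ => (x + t • EuclideanSpace.single j (1 : ℝ)) k) =
      fun t => x k + t * (if k = j then 1 else 0) := by
    ext t; simp
  rw [this]
  simpa using ((hasDerivAt_id (0 : ℝ)).mul_const (if k = j then (1 : ℝ) else 0)).const_add (x k)

lemma hasDerivAt_conformalFactor_line (x : Plane) (j : Fin 2) :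
    HasDerivAt (fun t : ℝ => conformalFactor (x + t • EuclideanSpace.single j (1 : ℝ)))
      (- conformalFactor x ^ 2 * x j) 0 := by
  have h := (one_add_sq_add_sq_pos (x 0) (x 1)).ne'
  have h' : 1 + ((x + (0 : ℝ) • EuclideanSpace.single j (1 : ℝ)) 0 ^ 2 +
    (x + (0 : ℝ) • EuclideanSpace.single j (1 : ℝ)) 1 ^ 2) ≠ 0 := by simpa using h
  have h1 := ((((hasDerivAt_line_apply x j 0).pow 2).add
    ((hasDerivAt_line_apply x j 1).pow 2)).const_add 1).inv h'
  refine ((h1.const_mul 2).congr_deriv ?_)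
  fin_cases j <;> (simp [conformalFactor]; field_simp)

lemma hasDerivAt_space {f : ℝ → Space} {f' : Space} {t : ℝ}
    (h : ∀ k, HasDerivAt (fun s => f s k) (f' k) t) : HasDerivAt f f' t :=
  (PiLp.continuousLinearEquiv 2 ℝ (fun _ : Fin 3 => ℝ)).symm.hasFDerivAt.comp_hasDerivAt t
    (hasDerivAt_pi.2 h)

lemma hasDerivAt_invStereoVal_line (x : Plane) (j : Fin 2) :
    HasDerivAt (fun t : ℝ => invStereoVal (x + t • EuclideanSpace.single j (1 : ℝ)))
      (tangentFrame j x) 0 := by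
  have hl := hasDerivAt_conformalFactor_line x j
  have h0 := hasDerivAt_line_apply x j 0
  have h1 := hasDerivAt_line_apply x j 1
  simp_rw [invStereoVal_eq]
  refine hasDerivAt_space ?_
  intro k
  fin_cases k
  · refine (hl.mul h0).congr_deriv ?_
    fin_cases j <;> (simp [tangentFrame]; try ring)
  · refine (hl.mul h1).congr_deriv ?_
    fin_cases j <;> (simp [tangentFrame]; try ring)
  · refine (hl.const_sub 1).congr_deriv ?_
    fin_cases j <;> simp [tangentFrame]

/-- The components `⟨∂ⱼΦ, X ∘ Φ⟩` of the pull-back of a vector field. -/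
def pullbackField (X : Space → Space) (j : Fin 2) (x : Plane) : ℝ :=
  inner ℝ (tangentFrame j x) (X (invStereoVal x))

lemma contDiff_pullbackField {X : Space → Space} (hX : ContDiff ℝ ∞ X) (j : Fin 2) :
    ContDiff ℝ ∞ (pullbackField X j) :=
  (contDiff_tangentFrame j).inner ℝ (hX.comp contDiff_invStereoVal)

/-- The pure second derivatives of the inverse stereographic projection. -/
def tangentFrameDeriv (j : Fin 2) (x : Plane) : Space :=
  ![!₂[-3 * conformalFactor x ^ 2 * x 0 + 2 * conformalFactor x ^ 3 * x 0 ^ 3,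
      2 * conformalFactor x ^ 3 * x 0 ^ 2 * x 1 - conformalFactor x ^ 2 * x 1,
      conformalFactor x ^ 2 - 2 * conformalFactor x ^ 3 * x 0 ^ 2],
    !₂[2 * conformalFactor x ^ 3 * x 1 ^ 2 * x 0 - conformalFactor x ^ 2 * x 0,
      -3 * conformalFactor x ^ 2 * x 1 + 2 * conformalFactor x ^ 3 * x 1 ^ 3,
      conformalFactor x ^ 2 - 2 * conformalFactor x ^ 3 * x 1 ^ 2]] j

/-- This is ΔΦ = -2 λ² Φ: the Laplacian of the chart is normal to the sphere, hence invisible to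
tangential fields. -/
lemma sum_inner_tangentFrameDeriv (x : Plane) (y : Space) :
    inner ℝ (tangentFrameDeriv 0 x) y + inner ℝ (tangentFrameDeriv 1 x) y =
      -2 * conformalFactor x ^ 2 * inner ℝ y (invStereoVal x) := by
  have h := conformalFactor_mul x
  simp only [invStereoVal_eq, inner_space]
  simp [tangentFrameDeriv]
  linear_combination (2 * conformalFactor x ^ 2 * (x 0 * y 0 + x 1 * y 1 - y 2)) * h

lemma hasDerivAt_tangentFrame_line (x : Plane) (j : Fin 2) :
    HasDerivAt (fun t : ℝ => tangentFrame j (x + t • EuclideanSpace.single j (1 : ℝ)))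
      (tangentFrameDeriv j x) 0 := by
  have hl := hasDerivAt_conformalFactor_line x j
  have h0 := hasDerivAt_line_apply x j 0
  have h1 := hasDerivAt_line_apply x j 1
  refine hasDerivAt_space fun k => ?_
  fin_cases j <;> fin_cases k
  · refine (hl.sub ((hl.pow 2).mul (h0.pow 2))).congr_deriv ?_
    simp [tangentFrameDeriv]; ring
  · refine (((hl.pow 2).neg.mul h0).mul h1).congr_deriv ?_
    simp [tangentFrameDeriv]; ring
  · refine ((hl.pow 2).mul h0).congr_deriv ?_
    simp [tangentFrameDeriv]; ring
  · refine (((hl.pow 2).neg.mul h0).mul h1).congr_deriv ?_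
    simp [tangentFrameDeriv]; ring
  · refine (hl.sub ((hl.pow 2).mul (h1.pow 2))).congr_deriv ?_
    simp [tangentFrameDeriv]; ring
  · refine ((hl.pow 2).mul h1).congr_deriv ?_
    simp [tangentFrameDeriv]; ring

/-- The two frame vectors divided by λ, together with Φ, form an orthonormal basis, and the trace
does not depend on the basis. -/
lemma sum_inner_tangentFrame (A : Space →L[ℝ] Space) (x : Plane) :
    inner ℝ (tangentFrame 0 x) (A (tangentFrame 0 x)) +
        inner ℝ (tangentFrame 1 x) (A (tangentFrame 1 x)) =
      conformalFactor x ^ 2 * ((∑ i : Fin 3, A (EuclideanSpace.single i 1) i) -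
        inner ℝ (A (invStereoVal x)) (invStereoVal x)) := by
  have hA (v : Space) (k : Fin 3) : A v k = v 0 * A (EuclideanSpace.single 0 1) k +
      v 1 * A (EuclideanSpace.single 1 1) k + v 2 * A (EuclideanSpace.single 2 1) k := by
    have hv : v = v 0 • EuclideanSpace.single 0 (1 : ℝ) + v 1 • EuclideanSpace.single 1 (1 : ℝ) +
        v 2 • EuclideanSpace.single 2 (1 : ℝ) := by
      ext i; fin_cases i <;> simp
    conv_lhs => rw [hv]
    simp
  have h := conformalFactor_mul x
  simp only [inner_space, Fin.sum_univ_three, hA (tangentFrame _ _), hA (invStereoVal _)]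
  simp only [invStereoVal_eq]
  generalize hl : conformalFactor x = l at *
  simp [tangentFrame, hl]
  generalize x.ofLp 0 = a at *
  generalize x.ofLp 1 = b at *
  generalize (A (EuclideanSpace.single 0 1)).ofLp 0 = a00
  generalize (A (EuclideanSpace.single 0 1)).ofLp 1 = a01
  generalize (A (EuclideanSpace.single 0 1)).ofLp 2 = a02
  generalize (A (EuclideanSpace.single 1 1)).ofLp 0 = a10
  generalize (A (EuclideanSpace.single 1 1)).ofLp 1 = a11
  generalize (A (EuclideanSpace.single 1 1)).ofLp 2 = a12
  generalize (A (EuclideanSpace.single 2 1)).ofLp 0 = a20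
  generalize (A (EuclideanSpace.single 2 1)).ofLp 1 = a21
  generalize (A (EuclideanSpace.single 2 1)).ofLp 2 = a22
  linear_combination (l ^ 3 * (a00 * a ^ 2 + a01 * a * b + a10 * a * b + a11 * b ^ 2
    - a02 * a - a12 * b - a20 * a - a21 * b + a22)) * h

/-- The conformal change of the divergence. -/
lemma divergence_pullbackField {X : Space → Space} (hX : ContDiff ℝ ∞ X)
    (hT : ∀ ξ : Sphere, inner ℝ (X ξ) (ξ : Space) = 0) (x : Plane) :
    ∑ j : Fin 2, fderiv ℝ (pullbackField X j) x (EuclideanSpace.single j 1) =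
      conformalFactor x ^ 2 * tangentialDiv X (invStereo x) := by
  have hd (j : Fin 2) : fderiv ℝ (pullbackField X j) x (EuclideanSpace.single j 1) =
      inner ℝ (tangentFrame j x) (fderiv ℝ X (invStereoVal x) (tangentFrame j x)) + inner ℝ
      (tangentFrameDeriv j x)
        (X (invStereoVal x)) := by
    have h1 : HasDerivAt (fun t : ℝ => x + t • EuclideanSpace.single j (1 : ℝ))
        (EuclideanSpace.single j 1) 0 := by
      simpa using ((hasDerivAt_id (0 : ℝ)).smul_const (EuclideanSpace.single j (1 : ℝ))).const_add x
    have hx : x + (0 : ℝ) • EuclideanSpace.single j (1 : ℝ) = x := by simp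
    have h2 : HasFDerivAt (pullbackField X j) (fderiv ℝ (pullbackField X j) x)
        (x + (0 : ℝ) • EuclideanSpace.single j (1 : ℝ)) := by
      rw [hx]
      exact ((contDiff_pullbackField hX j).differentiable (by simp)).differentiableAt.hasFDerivAt
    have h3 := h2.comp_hasDerivAt (0 : ℝ) h1
    have h4 : HasFDerivAt X (fderiv ℝ X (invStereoVal x))
        (invStereoVal (x + (0 : ℝ) • EuclideanSpace.single j (1 : ℝ))) := by
      rw [hx]
      exact (hX.differentiable (by simp)).differentiableAt.hasFDerivAt
    have h5 := h4.comp_hasDerivAt (0 : ℝ) (hasDerivAt_invStereoVal_line x j)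
    have h6 := (hasDerivAt_tangentFrame_line x j).inner ℝ h5
    rw [h3.unique h6, hx]
    simp
  -- Tangentiality removes the terms with second derivatives of Φ.
  have ht : inner ℝ (X (invStereoVal x)) (invStereoVal x) = 0 := hT (invStereo x)
  have hs := sum_inner_tangentFrame (fderiv ℝ X (invStereoVal x)) x
  have hs' := sum_inner_tangentFrameDeriv x (X (invStereoVal x))
  rw [ht] at hs'
  rw [Fin.sum_univ_two, hd, hd, tangentialDiv]
  simp only [invStereo]
  linarith

/-- X is bounded on the compact sphere, and the frame vectors have length λ. -/
lemma exists_abs_pullbackField_le {X : Space → Space} (hX : Continuous X) :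
    ∃ C, 0 ≤ C ∧ ∀ j x, |pullbackField X j x| ≤ C * conformalFactor x := by
  obtain ⟨C, hC⟩ := (isCompact_univ (X := Sphere)).exists_bound_of_continuousOn
    (f := fun ξ : Sphere => X ξ) (by fun_prop)
  refine ⟨C, (norm_nonneg _).trans (hC northPole trivial), fun j x => ?_⟩
  refine (abs_real_inner_le_norm _ _).trans ?_
  rw [norm_tangentFrame, mul_comm]
  exact mul_le_mul_of_nonneg_right (hC (invStereo x) trivial) (conformalFactor_pos x).le

lemma exists_abs_tangentialDiv_le {X : Space → Space} (hX : ContDiff ℝ ∞ X) :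
    ∃ C, 0 ≤ C ∧ ∀ ξ, |tangentialDiv X ξ| ≤ C := by
  have h := hX.continuous_fderiv (by simp)
  obtain ⟨C, hC⟩ := (isCompact_univ (X := Sphere)).exists_bound_of_continuousOn
    (f := tangentialDiv X) (by unfold tangentialDiv; fun_prop)
  exact ⟨C, (norm_nonneg _).trans (hC northPole trivial), fun ξ => hC ξ trivial⟩

/-! ### Cut-offs and integration by parts on the whole plane -/

lemma norm_sq_plane (x : Plane) : ‖x‖ ^ 2 = x 0 ^ 2 + x 1 ^ 2 := by
  simp [EuclideanSpace.norm_sq_eq, Fin.sum_univ_two]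

lemma conformalFactor_le (x : Plane) : conformalFactor x ≤ 4 * (1 + ‖x‖) ^ (-2 : ℝ) := by
  have h1 : (0 : ℝ) < 1 + ‖x‖ := by positivity
  rw [Real.rpow_neg h1.le, Real.rpow_two, conformalFactor, ← norm_sq_plane, ← div_eq_mul_inv,
    div_le_div_iff₀ (by positivity) (by positivity)]
  nlinarith [sq_nonneg (1 - ‖x‖)]

lemma integrable_one_add_norm_plane : Integrable fun x : Plane => (1 + ‖x‖) ^ (-3 : ℝ) :=
  integrable_one_add_norm (by simp; norm_num)

/-- Smooth cut-off functions on the plane whose gradients decay uniformly. -/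
lemma exists_cutoff : ∃ (φ : ℕ → Plane → ℝ) (K : ℝ), 0 ≤ K ∧ (∀ n, ContDiff ℝ ∞ (φ n)) ∧
    (∀ n, HasCompactSupport (φ n)) ∧ (∀ n x, |φ n x| ≤ 1) ∧
    (∀ x, ∀ᶠ n in atTop, φ n x = 1) ∧
    (∀ n x, ‖fderiv ℝ (φ n) x‖ ≤ K * (1 + ‖x‖)⁻¹) ∧
    ∀ x, Tendsto (fun n => fderiv ℝ (φ n) x) atTop (𝓝 0) := by
  let η : ContDiffBump (0 : Plane) := ⟨1, 2, one_pos, one_lt_two⟩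
  have hηc : ContDiff ℝ ∞ (η : Plane → ℝ) := η.contDiff
  obtain ⟨K, hK⟩ := (hηc.continuous_fderiv (by simp)).bounded_above_of_compact_support
    (η.hasCompactSupport.fderiv ℝ)
  have hK0 : 0 ≤ K := (norm_nonneg _).trans (hK 0)
  let c : ℕ → ℝ := fun n => ((n : ℝ) + 1)⁻¹
  have hc (n : ℕ) : 0 < c n := by positivity
  have hfd (n : ℕ) (x : Plane) : fderiv ℝ (fun y => η (c n • y)) x =
      c n • fderiv ℝ (η : Plane → ℝ) (c n • x) := by
    rw [fderiv_comp_smul]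
  have hbound (n : ℕ) (x : Plane) : ‖fderiv ℝ (fun y => η (c n • y)) x‖ ≤ c n * K := by
    rw [hfd, norm_smul, Real.norm_of_nonneg (hc n).le]
    exact mul_le_mul_of_nonneg_left (hK _) (hc n).le
  refine ⟨fun n x => η (c n • x), 3 * K, by positivity, fun n => hηc.comp (by fun_prop), fun n => ?_,
    fun n x => ?_, fun x => ?_, fun n x => ?_, fun x => ?_⟩
  · exact η.hasCompactSupport.comp_smul (hc n).ne'
  · rw [abs_of_nonneg η.nonneg]
    exact η.le_one
  · filter_upwards [eventually_ge_atTop ⌈‖x‖⌉₊] with n hn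
    apply η.one_of_mem_closedBall
    have : ‖x‖ ≤ n := (Nat.le_ceil _).trans (by exact_mod_cast hn)
    rw [mem_closedBall_zero_iff, norm_smul, Real.norm_of_nonneg (hc n).le]
    change ((n : ℝ) + 1)⁻¹ * ‖x‖ ≤ 1
    rw [inv_mul_le_iff₀ (by positivity)]
    linarith
  -- The derivative of the n-th cut-off vanishes for |x| > 2(n + 1). Elsewhere 1 + |x| ≤ 3(n + 1),
  -- which is where the constant 3K comes from.
  · by_cases hx : ‖x‖ ≤ 2 * (n + 1)
    · refine (hbound n x).trans ?_
      change ((n : ℝ) + 1)⁻¹ * K ≤ _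
      rw [inv_mul_le_iff₀ (by positivity)]
      have h1 : (1 + ‖x‖) * (1 + ‖x‖)⁻¹ = 1 := mul_inv_cancel₀ (by positivity)
      have h2 : 0 ≤ K * (1 + ‖x‖)⁻¹ := by positivity
      nlinarith
    · have h0 : fderiv ℝ (η : Plane → ℝ) (c n • x) = 0 := by
        apply image_eq_zero_of_notMem_tsupport
        intro h
        have h' := tsupport_fderiv_subset ℝ h
        rw [η.tsupport_eq, mem_closedBall_zero_iff, norm_smul, Real.norm_of_nonneg (hc n).le] at h'
        change ((n : ℝ) + 1)⁻¹ * ‖x‖ ≤ 2 at h'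
        rw [inv_mul_le_iff₀ (by positivity)] at h'
        linarith
      rw [hfd, h0]
      simp
      positivity
  · apply squeeze_zero_norm (fun n => hbound n x)
    have : Tendsto c atTop (𝓝 0) := by
      simpa [c, one_div] using tendsto_one_div_add_atTop_nhds_zero_nat (𝕜 := ℝ)
    simpa using this.mul_const K

/-- Integration by parts against vector fields that decay like the conformal factor. -/
lemma HasWeakGradient.integral_mul_divergence {v : Plane → ℝ} {G : Plane → Plane}
    (hv : HasWeakGradient v G) (hG : MemLp G 2) (hb : ∀ᵐ x, |v x| ≤ 1)
    {V : Fin 2 → Plane → ℝ} (hV : ∀ j, ContDiff ℝ ∞ (V j)) {C : ℝ} (hC : 0 ≤ C)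
    (hVb : ∀ j x, |V j x| ≤ C * conformalFactor x)
    (hdiv : ∀ x, |∑ j, fderiv ℝ (V j) x (EuclideanSpace.single j 1)| ≤
      C * conformalFactor x ^ 2) :
    ∫ x, v x * ∑ j, fderiv ℝ (V j) x (EuclideanSpace.single j 1) = - ∫ x, ∑ j, G x j * V j x := by
  obtain ⟨φ, K, hK, hφ, hφc, hφ1, hφe, hφd, hφt⟩ := exists_cutoff
  have hGi (j : Fin 2) : MemLp (fun x => G x j) 2 :=
    (EuclideanSpace.proj (𝕜 := ℝ) j : Plane →L[ℝ] ℝ).comp_memLp' hG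
  have hVm (j : Fin 2) : AEStronglyMeasurable (V j) := (hV j).continuous.aestronglyMeasurable
  have hVL (j : Fin 2) : MemLp (V j) 2 := by
    rw [memLp_two_iff_integrable_sq (hVm j)]
    refine (integrable_conformalFactor_sq.const_mul (C ^ 2)).mono' ((hVm j).pow 2)
      (Eventually.of_forall fun x => ?_)
    rw [Real.norm_of_nonneg (sq_nonneg _), ← mul_pow, ← sq_abs]
    exact pow_le_pow_left₀ (abs_nonneg _) (hVb j x) 2
  have hGV (j : Fin 2) : Integrable (fun x => G x j * V j x) := (hGi j).integrable_mul (hVL j)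
  have hprod (n : ℕ) (j : Fin 2) (x : Plane) :
      fderiv ℝ (fun y => φ n y * V j y) x (EuclideanSpace.single j 1) =
        φ n x * fderiv ℝ (V j) x (EuclideanSpace.single j 1) +
          V j x * fderiv ℝ (φ n) x (EuclideanSpace.single j 1) := by
    rw [fderiv_fun_mul ((hφ n).differentiable (by simp)).differentiableAt
      ((hV j).differentiable (by simp)).differentiableAt]
    simp
  have hcd (n : ℕ) (j : Fin 2) : ContDiff ℝ ∞ fun y => φ n y * V j y := (hφ n).mul (hV j)
  have hcs (n : ℕ) (j : Fin 2) : HasCompactSupport fun y => φ n y * V j y := (hφc n).mul_right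
  have hfc {f : Plane → ℝ} (hf : ContDiff ℝ ∞ f) (j : Fin 2) :
      Continuous fun x => fderiv ℝ f x (EuclideanSpace.single j 1) :=
    (hf.continuous_fderiv (by simp)).clm_apply continuous_const
  have hid (n : ℕ) : ∫ x, v x * ∑ j, fderiv ℝ (fun y => φ n y * V j y) x
      (EuclideanSpace.single j 1) = - ∫ x, φ n x * ∑ j, G x j * V j x := by
    simp_rw [Finset.mul_sum]
    rw [integral_finsetSum, integral_finsetSum, ← Finset.sum_neg_distrib]
    · refine Finset.sum_congr rfl fun j _ => ?_
      rw [hv.integral_eq _ (hcd n j) (hcs n j)]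
      congr 2
      ext x
      ring
    · intro j _
      refine (hGV j).bdd_mul (hφ n).continuous.aestronglyMeasurable (c := 1)
        (Eventually.of_forall fun x => hφ1 n x)
    · intro j _
      exact hv.locallyIntegrable.integrable_smul_right_of_hasCompactSupport (hfc (hcd n j) j)
        (((hcs n j).fderiv ℝ).comp_left (g := fun L : Plane →L[ℝ] ℝ =>
          L (EuclideanSpace.single j 1)) (by simp))
  have hlim1 : Tendsto (fun n => ∫ x, v x * ∑ j, fderiv ℝ (fun y => φ n y * V j y) x
      (EuclideanSpace.single j 1)) atTop
      (𝓝 (∫ x, v x * ∑ j, fderiv ℝ (V j) x (EuclideanSpace.single j 1))) := by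
    -- The first term dominates φₙ div V. The second dominates V · ∇φₙ: λ ≤ 4(1 + |x|)⁻² and |∇φₙ| ≤
    -- K(1 + |x|)⁻¹, over two components, give 8CK(1 + |x|)⁻³, integrable as 3 > 2.
    refine tendsto_integral_of_dominated_convergence
      (fun x => C * conformalFactor x ^ 2 + 8 * C * K * (1 + ‖x‖) ^ (-3 : ℝ)) (fun n => ?_) ?_
      (fun n => ?_) ?_
    · refine hv.locallyIntegrable.aestronglyMeasurable.mul ?_
      exact (continuous_finsetSum _ fun j _ => hfc (hcd n j) j).aestronglyMeasurable
    · exact (integrable_conformalFactor_sq.const_mul C).add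
        (integrable_one_add_norm_plane.const_mul _)
    · filter_upwards [hb] with x hx
      have h1 (j : Fin 2) : |V j x * fderiv ℝ (φ n) x (EuclideanSpace.single j 1)| ≤
          4 * C * K * (1 + ‖x‖) ^ (-3 : ℝ) := by
        rw [abs_mul]
        have h2 : |fderiv ℝ (φ n) x (EuclideanSpace.single j 1)| ≤ K * (1 + ‖x‖)⁻¹ := by
          refine ((fderiv ℝ (φ n) x).le_opNorm _).trans ?_
          simpa using hφd n x
        have h3 : |V j x| ≤ C * (4 * (1 + ‖x‖) ^ (-2 : ℝ)) :=
          (hVb j x).trans (mul_le_mul_of_nonneg_left (conformalFactor_le x) hC)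
        refine (mul_le_mul h3 h2 (abs_nonneg _) (by positivity)).trans_eq ?_
        have h4 : (0 : ℝ) < 1 + ‖x‖ := by positivity
        have : (1 + ‖x‖) ^ (-3 : ℝ) = (1 + ‖x‖) ^ (-2 : ℝ) * (1 + ‖x‖)⁻¹ := by
          rw [← Real.rpow_neg_one, ← Real.rpow_add h4]
          norm_num
        rw [this]
        ring
      rw [norm_mul, Real.norm_eq_abs, Real.norm_eq_abs]
      refine (mul_le_of_le_one_left (abs_nonneg _) hx).trans ?_
      simp_rw [hprod, Finset.sum_add_distrib, ← Finset.mul_sum]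
      refine (abs_add_le _ _).trans (add_le_add ?_ ?_)
      · rw [abs_mul]
        exact (mul_le_of_le_one_left (abs_nonneg _) (hφ1 n x)).trans (hdiv x)
      · rw [Fin.sum_univ_two]
        refine (abs_add_le _ _).trans ?_
        linarith [h1 0, h1 1]
    · refine Eventually.of_forall fun x => Tendsto.const_mul _ ?_
      refine tendsto_finsetSum _ fun j _ => ?_
      simp_rw [hprod]
      have e1 : Tendsto (fun n => φ n x) atTop (𝓝 1) :=
        tendsto_const_nhds.congr' ((hφe x).mono fun n h => h.symm)
      have e2 : Tendsto (fun n => fderiv ℝ (φ n) x (EuclideanSpace.single j 1)) atTop (𝓝 0) := by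
        simpa [Function.comp_def] using ((ContinuousLinearMap.apply ℝ ℝ
          (EuclideanSpace.single j (1 : ℝ) : Plane)).continuous.tendsto 0).comp (hφt x)
      simpa using (e1.mul_const (fderiv ℝ (V j) x (EuclideanSpace.single j 1))).add
        (e2.const_mul (V j x))
  have hlim2 : Tendsto (fun n => ∫ x, φ n x * ∑ j, G x j * V j x) atTop
      (𝓝 (∫ x, ∑ j, G x j * V j x)) := by
    have hs : Integrable fun x => ∑ j, G x j * V j x := integrable_finsetSum _ fun j _ => hGV j
    refine tendsto_integral_of_dominated_convergence (fun x => ‖∑ j, G x j * V j x‖) (fun n => ?_)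
      hs.norm (fun n => ?_) ?_
    · exact (hφ n).continuous.aestronglyMeasurable.mul hs.aestronglyMeasurable
    · refine Eventually.of_forall fun x => ?_
      rw [norm_mul]
      exact mul_le_of_le_one_left (norm_nonneg _) (hφ1 n x)
    · refine Eventually.of_forall fun x => ?_
      exact tendsto_const_nhds.congr' ((hφe x).mono fun n h => by simp only [h, one_mul])
  simp_rw [hid] at hlim1
  exact tendsto_nhds_unique hlim1 hlim2.neg

/-! ### Sobolev regularity on the sphere -/

/-- The tangential gradient of `v ∘ stereo` in terms of the gradient of `v`. -/
def sphereGradient (G : Plane → Plane) (ξ : Sphere) : Space :=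
  (conformalFactor (stereo ξ) ^ 2)⁻¹ • ∑ j, G (stereo ξ) j • tangentFrame j (stereo ξ)

/-- The frame is orthogonal with vectors of length λ, so the squared gradient is λ⁻²|G|², and the
density λ² of the surface measure cancels the factor. -/
lemma memLp_sphereGradient {G : Plane → Plane} (hG : MemLp G 2) :
    MemLp (sphereGradient G) 2 surface := by
  have hm := measurable_conformalFactor
  have hGi (j : Fin 2) : MemLp (fun x => G x j) 2 :=
    (EuclideanSpace.proj (𝕜 := ℝ) j : Plane →L[ℝ] ℝ).comp_memLp' hG
  have hme : AEStronglyMeasurable (sphereGradient G) surface := by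
    apply aestronglyMeasurable_surface
    have : sphereGradient G ∘ invStereo = fun x =>
        (conformalFactor x ^ 2)⁻¹ • ∑ j, G x j • tangentFrame j x := by
      ext x
      simp [sphereGradient, stereo_invStereo]
    rw [this]
    refine AEStronglyMeasurable.smul (f := fun x => (conformalFactor x ^ 2)⁻¹)
      (hm.pow_const 2).inv.aestronglyMeasurable ?_
    refine Finset.aestronglyMeasurable_fun_sum _ fun j _ => ?_
    exact (hGi j).aestronglyMeasurable.smul (contDiff_tangentFrame j).continuous.aestronglyMeasurable
  rw [memLp_two_iff_integrable_sq_norm hme, integrable_surface_iff]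
  refine (memLp_two_iff_integrable_sq_norm hG.aestronglyMeasurable).1 hG |>.congr
    (Eventually.of_forall fun x => ?_)
  have h0 := (conformalFactor_pos x).ne'
  have h : ‖∑ j, G x j • tangentFrame j x‖ ^ 2 = conformalFactor x ^ 2 * ‖G x‖ ^ 2 := by
    rw [Fin.sum_univ_two, norm_add_sq_real, norm_smul, norm_smul, inner_smul_left, inner_smul_right,
      inner_tangentFrame_zero_one, norm_sq_plane, norm_tangentFrame, norm_tangentFrame]
    simp only [mul_pow, Real.norm_eq_abs, sq_abs]
    simp
    ring
  simp only [sphereGradient, stereo_invStereo, norm_smul, mul_pow, h, smul_eq_mul, norm_inv,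
    norm_pow, Real.norm_eq_abs, sq_abs]
  field_simp

/-- In the chart, testing against X is testing v against the pulled-back field. That field and its
divergence are O(λ) and O(λ²), exactly the decay required by
`HasWeakGradient.integral_mul_divergence`. -/
lemma HasWeakGradient.hasWeakTangentialGradient {v : Plane → ℝ} {G : Plane → Plane}
    (hv : HasWeakGradient v G) (hG : MemLp G 2) (hb : ∀ᵐ x, |v x| ≤ 1) :
    MemLp (fun ξ => v (stereo ξ)) 2 surface ∧
      HasWeakTangentialGradient (fun ξ => v (stereo ξ)) (sphereGradient G) := by
  have hvm : AEStronglyMeasurable (fun ξ => v (stereo ξ)) surface := by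
    apply aestronglyMeasurable_surface
    have : (fun ξ => v (stereo ξ)) ∘ invStereo = v := by
      ext x
      simp [stereo_invStereo]
    rw [this]
    exact hv.locallyIntegrable.aestronglyMeasurable
  have hvL : MemLp (fun ξ => v (stereo ξ)) 2 surface :=
    MemLp.of_bound hvm 1 (ae_surface_stereo hb)
  refine ⟨hvL, hvL.integrable (by norm_num), (memLp_sphereGradient hG).integrable (by norm_num),
    ?_, fun X hX hT => ?_⟩
  · rw [ae_surface_iff]
    refine Eventually.of_forall fun x => ?_
    simp only [sphereGradient, stereo_invStereo, inner_smul_left, sum_inner,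
      inner_tangentFrame_invStereo, mul_zero, Finset.sum_const_zero]
  · obtain ⟨C₁, h₁, hC₁⟩ := exists_abs_pullbackField_le hX.continuous
    obtain ⟨C₂, h₂, hC₂⟩ := exists_abs_tangentialDiv_le hX
    have key := hv.integral_mul_divergence hG hb (contDiff_pullbackField hX) (C := max C₁ C₂)
      (h₁.trans (le_max_left _ _)) (fun j x => (hC₁ j x).trans
        (mul_le_mul_of_nonneg_right (le_max_left _ _) (conformalFactor_pos x).le)) (fun x => by
        rw [divergence_pullbackField hX hT, abs_mul, abs_of_nonneg (sq_nonneg _), mul_comm]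
        exact mul_le_mul_of_nonneg_right ((hC₂ _).trans (le_max_right _ _)) (sq_nonneg _))
    rw [integral_surface, integral_surface]
    convert key using 1
    · congr 1
      ext x
      rw [divergence_pullbackField hX hT, stereo_invStereo, smul_eq_mul]
      ring
    · congr 2
      ext x
      have h0 := (conformalFactor_pos x).ne'
      simp only [sphereGradient, stereo_invStereo, inner_smul_left, sum_inner, pullbackField,
        smul_eq_mul]
      simp only [invStereo, conj_trivial]
      field_simp

/-- Composition with the stereographic projection preserves the Sobolev class. -/
theorem memSobolevSphere_comp_stereo {m : Plane → Space} (hm : MemHomSobolevSphere m) :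
    MemSobolevSphere fun ξ => m (stereo ξ) := by
  refine ⟨fun i => ?_, ae_surface_stereo hm.2⟩
  obtain ⟨G, hG, hG2⟩ := hm.1 i
  have hb : ∀ᵐ x, |m x i| ≤ 1 := by
    filter_upwards [hm.2] with x hx
    rw [← hx]
    exact PiLp.norm_apply_le (m x) i
  obtain ⟨h1, h2⟩ := hG.hasWeakTangentialGradient hG2 hb
  exact ⟨h1, _, h2, memLp_sphereGradient hG2⟩

/-! ### Oscillation along lines and the sign at infinity -/

/-- If `u` is a.e. a primitive of `p`, then `u - u³/3` varies by at most the integral of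
`|(1 - u²) p|`. -/
lemma ae_abs_sub_le_integral_of_primitive {u p : ℝ → ℝ} (hp : LocallyIntegrable p)
    {x₀ : ℝ} (hu : ∀ᵐ h, u (x₀ + h) - u x₀ = ∫ t in (0 : ℝ)..h, p (x₀ + t))
    (hi : Integrable fun x => (1 - u x ^ 2) * p x) :
    ∀ᵐ x, ∀ᵐ x', |(u x - u x ^ 3 / 3) - (u x' - u x' ^ 3 / 3)| ≤ ∫ t, |(1 - u t ^ 2) * p t| := by
  have hpi (a b : ℝ) : IntervalIntegrable p volume a b :=
    intervalIntegrable_iff.2 ((hp.integrableOn_isCompact isCompact_uIcc).mono_set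
      Set.uIoc_subset_uIcc)
  -- The absolutely continuous representative of u, for which the fundamental theorem of calculus
  -- holds between any two points.
  set U : ℝ → ℝ := fun x => u x₀ + ∫ t in x₀..x, p t with hU
  have huU : ∀ᵐ x, u x = U x := by
    have := (measurePreserving_add_left volume (-x₀)).quasiMeasurePreserving.ae hu
    filter_upwards [this] with x hx
    rw [intervalIntegral.integral_comp_add_left] at hx
    simp only [add_neg_cancel_left, add_zero] at hx
    simp only [hU]
    linarith
  have hac (a b : ℝ) : AbsolutelyContinuousOnInterval U a b := by
    have h1 := (hpi a b).absolutelyContinuousOnInterval_intervalIntegral (c := a) (by simp)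
    have h2 : AbsolutelyContinuousOnInterval (fun _ : ℝ => U a) a b :=
      (contDiff_const (n := 1)).contDiffOn.absolutelyContinuousOnInterval
    have h3 : (fun x => ∫ t in a..x, p t) + (fun _ : ℝ => U a) = U := by
      funext x
      simp only [hU, Pi.add_apply]
      rw [← intervalIntegral.integral_add_adjacent_intervals (hpi x₀ a) (hpi a x)]
      ring
    exact h3 ▸ h1.add h2
  have hder : ∀ᵐ x, HasDerivAt U (p x) x := by
    filter_upwards [LocallyIntegrable.ae_hasDerivAt_integral hp] with x hx
    exact (hx x₀).const_add _
  have hmain (a b : ℝ) : |(U a - U a ^ 3 / 3) - (U b - U b ^ 3 / 3)| ≤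
      ∫ t, |(1 - u t ^ 2) * p t| := by
    have hg : AbsolutelyContinuousOnInterval (fun x => U x - (1 / 3) * (U x * (U x * U x))) b a :=
      (hac b a).sub (((hac b a).mul ((hac b a).mul (hac b a))).const_mul (1 / 3))
    have h1 := hg.integral_deriv_eq_sub
    have h2 : ∫ x in b..a, deriv (fun x => U x - (1 / 3) * (U x * (U x * U x))) x =
        ∫ x in b..a, (1 - u x ^ 2) * p x := by
      apply intervalIntegral.integral_congr_ae
      filter_upwards [hder, huU] with x hx hx' _
      have hd : HasDerivAt (fun x => U x - (1 / 3) * (U x * (U x * U x))) _ x :=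
        hx.sub ((hx.mul (hx.mul hx)).const_mul (1 / 3))
      rw [hd.deriv, hx']
      simp only [Pi.mul_apply]
      ring
    rw [h2] at h1
    have h3 : (U a - U a ^ 3 / 3) - (U b - U b ^ 3 / 3) = ∫ x in b..a, (1 - u x ^ 2) * p x := by
      rw [h1]; ring
    rw [h3]
    refine (intervalIntegral.norm_integral_le_integral_norm_uIoc
      (f := fun x => (1 - u x ^ 2) * p x)).trans ?_
    exact setIntegral_le_integral hi.norm (Eventually.of_forall fun _ => norm_nonneg _)
  filter_upwards [huU] with x hx
  filter_upwards [huU] with x' hx'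
  rw [hx, hx']
  exact hmain x x'

/-- A function of two variables whose oscillation along the lines in the two coordinate directions
is bounded by integrable functions of the transversal coordinate differs from a constant by a
square integrable function. -/
lemma exists_integrable_sq_sub_const {φ : ℝ × ℝ → ℝ} (hφ : Measurable φ) {M : ℝ}
    (hM : ∀ z, |φ z| ≤ M) {a b : ℝ → ℝ} (ha : Integrable a) (hb : Integrable b)
    (hA : ∀ᵐ w : (ℝ × ℝ) × ℝ, |φ w.1 - φ (w.1.1, w.2)| ≤ a w.1.1)
    (hB : ∀ᵐ w : (ℝ × ℝ) × ℝ, |φ w.1 - φ (w.2, w.1.2)| ≤ b w.1.2) :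
    ∃ c, Integrable fun z => (φ z - c) ^ 2 := by
  have q1 : Measure.QuasiMeasurePreserving (fun w : (ℝ × ℝ) × (ℝ × ℝ) => (w.1, w.2.2)) :=
    QuasiMeasurePreserving.prodMap (.id _) Measure.quasiMeasurePreserving_snd
  have q2 : Measure.QuasiMeasurePreserving (fun w : (ℝ × ℝ) × (ℝ × ℝ) => (w.1, w.2.1)) :=
    QuasiMeasurePreserving.prodMap (.id _) Measure.quasiMeasurePreserving_fst
  have qs : Measure.QuasiMeasurePreserving (Prod.swap : (ℝ × ℝ) × (ℝ × ℝ) → _) volume volume :=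
    Measure.measurePreserving_swap.quasiMeasurePreserving
  -- Two points are joined through either of the other two corners of the rectangle they span. Each
  -- path gives one of the bounds.
  have h4 : ∀ᵐ w : (ℝ × ℝ) × (ℝ × ℝ),
      |φ w.2 - φ w.1| ≤ a w.2.1 + b w.1.2 ∧ |φ w.2 - φ w.1| ≤ a w.1.1 + b w.2.2 := by
    filter_upwards [q1.ae hA, q2.ae hB, (q1.comp qs).ae hA, (q2.comp qs).ae hB] with w h1 h2 h3 h4
    simp only [Function.comp, Prod.fst_swap, Prod.snd_swap] at h1 h2 h3 h4
    rw [abs_le] at *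
    rw [abs_le]
    constructor <;> constructor <;> linarith [h1.1, h1.2, h2.1, h2.2, h3.1, h3.2, h4.1, h4.2]
  have h5 : ∀ᵐ z' : ℝ × ℝ, ∀ᵐ z : ℝ × ℝ,
      |φ z - φ z'| ≤ a z.1 + b z'.2 ∧ |φ z - φ z'| ≤ a z'.1 + b z.2 :=
    Measure.ae_ae_of_ae_prod h4
  -- Otherwise g ≥ ε almost everywhere on a line of infinite length.
  have hsmall {g : ℝ → ℝ} (hg : Integrable g) {ε : ℝ} (hε : 0 < ε) : volume {t | g t < ε} ≠ 0 := by
    intro h0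
    have h1 : volume {t | ε ≤ ‖g t‖} < ⊤ := hg.measure_norm_ge_lt_top hε
    have h2 : (Set.univ : Set ℝ) ⊆ {t | g t < ε} ∪ {t | ε ≤ ‖g t‖} := by
      intro t _
      rcases lt_or_ge (g t) ε with h | h
      · exact Or.inl h
      · exact Or.inr (h.trans (le_abs_self _))
    have h3 := (measure_mono h2).trans (measure_union_le (μ := volume) _ _)
    rw [h0, zero_add, Real.volume_univ] at h3
    exact absurd h1 (not_lt.2 h3)
  -- Base points at which both a and b are small; c will be a limit point of the values of φ there.
  have hex (n : ℕ) : ∃ z' : ℝ × ℝ, a z'.1 < 1 / ((n : ℝ) + 1) ∧ b z'.2 < 1 / ((n : ℝ) + 1) ∧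
      ∀ᵐ z : ℝ × ℝ, |φ z - φ z'| ≤ a z.1 + b z'.2 ∧ |φ z - φ z'| ≤ a z'.1 + b z.2 := by
    by_contra hcon
    have h0 : volume ({t | a t < 1 / ((n : ℝ) + 1)} ×ˢ {t | b t < 1 / ((n : ℝ) + 1)}) = 0 := by
      refine measure_mono_null (fun z' hz' => ?_) (ae_iff.1 h5)
      intro h
      exact hcon ⟨z', hz'.1, hz'.2, h⟩
    rw [Measure.volume_eq_prod, Measure.prod_prod, mul_eq_zero] at h0
    have hn : (0 : ℝ) < 1 / ((n : ℝ) + 1) := by positivity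
    rcases h0 with h | h
    · exact hsmall ha hn h
    · exact hsmall hb hn h
  choose z' hza hzb hz using hex
  obtain ⟨c, -, ψ, hψ, hc⟩ := tendsto_subseq_of_bounded (x := fun n => φ (z' n))
    (Metric.isBounded_closedBall (x := (0 : ℝ)) (r := M))
    (fun n => by simpa using hM (z' n))
  refine ⟨c, ?_⟩
  have h6 : ∀ᵐ z : ℝ × ℝ, |φ z - c| ≤ a z.1 ∧ |φ z - c| ≤ b z.2 := by
    filter_upwards [ae_all_iff.2 hz] with z hz
    have e1 : Tendsto (fun n => |φ z - φ (z' (ψ n))|) atTop (𝓝 |φ z - c|) :=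
      (tendsto_const_nhds.sub hc).abs
    have e2 : Tendsto (fun n => 1 / ((ψ n : ℝ) + 1)) atTop (𝓝 0) :=
      (tendsto_one_div_add_atTop_nhds_zero_nat (𝕜 := ℝ)).comp hψ.tendsto_atTop
    constructor
    · refine le_of_tendsto_of_tendsto' e1 (by simpa only [add_zero] using e2.const_add (a z.1)) fun n => ?_
      exact (hz (ψ n)).1.trans (add_le_add_right (hzb (ψ n)).le _)
    · refine le_of_tendsto_of_tendsto' e1 (by simpa only [zero_add] using e2.add_const (b z.2)) fun n => ?_
      exact (hz (ψ n)).2.trans (add_le_add_left (hza (ψ n)).le _)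
  -- The two bounds for |φ - c| are multiplied: a(x) b(y) is integrable on the plane, though neither
  -- factor alone is in general.
  refine (ha.mul_prod hb).mono' ((hφ.sub_const c).pow_const 2).aestronglyMeasurable ?_
  filter_upwards [h6] with z hz
  rw [Real.norm_of_nonneg (sq_nonneg _), ← sq_abs, sq]
  exact mul_le_mul hz.1 hz.2 (abs_nonneg _) ((abs_nonneg _).trans hz.1)

/-- On a space of infinite measure, if `1 - f²` is integrable and `f - f³/3` differs from a constant
by a square integrable function, then one of `1 - f` and `1 + f` is integrable. -/
lemma exists_sign_of_integrable_sq {α : Type*} [MeasurableSpace α] {μ : Measure α}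
    (hμ : μ Set.univ = ⊤) {f : α → ℝ} (hf : Measurable f) (hb : ∀ z, |f z| ≤ 1)
    (hi : Integrable (fun z => 1 - f z ^ 2) μ) {c : ℝ}
    (hc : Integrable (fun z => ((f z - f z ^ 3 / 3) - c) ^ 2) μ) :
    ∃ s : ℝ, s ^ 2 = 1 ∧ Integrable (fun z => 1 - s * f z) μ := by
  by_cases h : ∃ s : ℝ, s ^ 2 = 1 ∧ c = s * (2 / 3)
  · obtain ⟨s, hs, rfl⟩ := h
    refine ⟨s, hs, ((hc.add hi).const_mul 2).mono' (by fun_prop) (Eventually.of_forall fun z => ?_)⟩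
    obtain ⟨h1, h2⟩ := abs_le.1 (hb z)
    have hs' : s = 1 ∨ s = -1 := by
      rcases mul_eq_zero.1 (show (s - 1) * (s + 1) = 0 by linarith) with h | h
      · left; linarith
      · right; linarith
    -- Here 2/3 - t + t³/3 = (1 - t)² (2 + t) / 3. Near t = 1 the term 1 - t² controls 1 - t; near t
    -- = -1 the square does.
    have key (t : ℝ) (h1 : -1 ≤ t) (h2 : t ≤ 1) :
        1 - t ≤ 2 * ((t - t ^ 3 / 3 - 2 / 3) ^ 2 + (1 - t ^ 2)) := by
      have e : 2 * ((t - t ^ 3 / 3 - 2 / 3) ^ 2 + (1 - t ^ 2)) - (1 - t) =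
        (1 - t) * (2 * ((1 - t) ^ 3 * (2 + t) ^ 2 / 9 + (1 + t)) - 1) := by ring
      have h3 : (1 - t) ^ 3 ≤ (1 - t) ^ 3 * (2 + t) ^ 2 :=
        le_mul_of_one_le_right (pow_nonneg (by linarith) 3) (by nlinarith)
      have h4 : 0 ≤ 2 * ((1 - t) ^ 3 * (2 + t) ^ 2 / 9 + (1 + t)) - 1 := by
        nlinarith [mul_nonneg (show 0 ≤ 1 - t by linarith) (sq_nonneg (1 + t)),
          mul_nonneg (show 0 ≤ 1 + t by linarith) (sq_nonneg (1 + t))]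
      have := mul_nonneg (show 0 ≤ 1 - t by linarith) h4
      linarith
    simp only [Pi.add_apply]
    rcases hs' with rfl | rfl
    · rw [Real.norm_of_nonneg (by linarith)]
      have := key (f z) h1 h2
      convert this using 1 <;> ring
    · rw [Real.norm_of_nonneg (by linarith)]
      have := key (-f z) (by linarith) (by linarith)
      convert this using 1 <;> ring
  · exfalso
    have h1 : c ≠ 2 / 3 := fun h1 => h ⟨1, by norm_num, by linarith⟩
    have h2 : c ≠ -(2 / 3) := fun h2 => h ⟨-1, by norm_num, by linarith⟩
    -- For other c the sum of the two integrands, as a function of t in [-1, 1], has no zero, hence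
    -- a positive minimum. This contradicts integrability on a space of infinite measure.
    obtain ⟨t₀, ht₀, hmin⟩ := (isCompact_Icc (a := (-1 : ℝ)) (b := 1)).exists_isMinOn
      (Set.nonempty_Icc.2 (by norm_num))
      (f := fun t : ℝ => (t - t ^ 3 / 3 - c) ^ 2 + (1 - t ^ 2)) (by fun_prop)
    have hpos : 0 < (t₀ - t₀ ^ 3 / 3 - c) ^ 2 + (1 - t₀ ^ 2) := by
      have hq : 0 ≤ 1 - t₀ ^ 2 := by nlinarith [ht₀.1, ht₀.2]
      rcases hq.lt_or_eq with hq | hq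
      · positivity
      · rcases mul_eq_zero.1 (show (t₀ - 1) * (t₀ + 1) = 0 by linarith) with h | h
        · have : t₀ = 1 := by linarith
          subst this
          have : (1 : ℝ) - 1 ^ 3 / 3 - c ≠ 0 := by intro h; apply h1; linarith
          positivity
        · have : t₀ = -1 := by linarith
          subst this
          have : (-1 : ℝ) - (-1) ^ 3 / 3 - c ≠ 0 := by intro h; apply h2; linarith
          positivity
    have h3 := (hc.add hi).measure_norm_ge_lt_top hpos
    have h4 : {z | (t₀ - t₀ ^ 3 / 3 - c) ^ 2 + (1 - t₀ ^ 2) ≤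
        ‖((fun z => ((f z - f z ^ 3 / 3) - c) ^ 2) + (fun z => 1 - f z ^ 2) : α → ℝ) z‖} = Set.univ := by
      apply Set.eq_univ_of_forall
      intro z
      exact le_trans (isMinOn_iff.1 hmin (f z) (abs_le.1 (hb z))) (le_abs_self _)
    rw [h4, hμ] at h3
    exact lt_irrefl _ h3

/-- Along almost every line the oscillation of `f - f³/3` is bounded by an integrable function of
the transversal coordinate. -/
lemma exists_integrable_oscillation_bound {f p : ℝ × ℝ → ℝ} (hf : Measurable f) (hp : Measurable p)
    (hb : ∀ z, |f z| ≤ 1) (hi : Integrable fun z => 1 - f z ^ 2) (hp2 : Integrable fun z => p z ^ 2)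
    (H : ∀ h, ∀ᵐ z : ℝ × ℝ, f (z.1, z.2 + h) - f z = ∫ t in (0 : ℝ)..h, p (z.1, z.2 + t)) :
    ∃ a : ℝ → ℝ, Integrable a ∧ ∀ᵐ w : (ℝ × ℝ) × ℝ,
      |(f w.1 - f w.1 ^ 3 / 3) - (f (w.1.1, w.2) - f (w.1.1, w.2) ^ 3 / 3)| ≤ a w.1.1 := by
  -- With q = 1 - f² in [0, 1], |q p| ≤ (q² + p²) / 2 ≤ q + p².
  have hint : Integrable fun z => (1 - f z ^ 2) * p z := by
    refine (hi.add hp2).mono' (by fun_prop) (Eventually.of_forall fun z => ?_)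
    have h1 : f z ^ 2 ≤ 1 := by rw [← sq_abs]; exact pow_le_one₀ (abs_nonneg _) (hb z)
    have h2 : 0 ≤ f z ^ 2 := sq_nonneg _
    simp only [Pi.add_apply, Real.norm_eq_abs]
    rw [abs_le]
    constructor <;> nlinarith [sq_nonneg (1 - f z ^ 2 + p z), sq_nonneg (1 - f z ^ 2 - p z)]
  set a : ℝ → ℝ := fun y => ∫ x, |(1 - f (y, x) ^ 2) * p (y, x)| with ha
  have hai : Integrable a := hint.norm.integral_prod_left
  have ham : Measurable a := by
    have : StronglyMeasurable fun z => |(1 - f z ^ 2) * p z| := by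
      apply Measurable.stronglyMeasurable; fun_prop
    exact this.integral_prod_right'.measurable
  refine ⟨a, hai, ?_⟩
  -- Rescaling to the fixed interval (0, 1] turns the moving endpoint into a parameter of the
  -- integrand.
  have hD : Measurable fun w : (ℝ × ℝ) × ℝ => ∫ t in (0 : ℝ)..w.2, p (w.1.1, w.1.2 + t) := by
    have h1 (w : (ℝ × ℝ) × ℝ) : ∫ t in (0 : ℝ)..w.2, p (w.1.1, w.1.2 + t) =
        w.2 * ∫ s in Set.Ioc (0 : ℝ) 1, p (w.1.1, w.1.2 + w.2 * s) := by
      rw [← intervalIntegral.integral_of_le zero_le_one, ← smul_eq_mul,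
        intervalIntegral.smul_integral_comp_mul_left (fun t => p (w.1.1, w.1.2 + t))]
      simp
    simp_rw [h1]
    have h2 : StronglyMeasurable fun w : ((ℝ × ℝ) × ℝ) × ℝ =>
        p (w.1.1.1, w.1.1.2 + w.1.2 * w.2) := by
      apply Measurable.stronglyMeasurable; fun_prop
    exact measurable_snd.mul h2.integral_prod_right'.measurable
  have hS : MeasurableSet {w : (ℝ × ℝ) × ℝ | f (w.1.1, w.1.2 + w.2) - f w.1 =
      ∫ t in (0 : ℝ)..w.2, p (w.1.1, w.1.2 + t)} :=
    measurableSet_eq_fun (by fun_prop) hD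
  -- The exceptional set depends on h. Fubini exchanges the quantifiers, so on almost every line
  -- some x₀ serves almost all h.
  have h1 : ∀ᵐ z : ℝ × ℝ, ∀ᵐ h : ℝ, f (z.1, z.2 + h) - f z =
      ∫ t in (0 : ℝ)..h, p (z.1, z.2 + t) :=
    (Measure.ae_ae_comm hS).2 (Eventually.of_forall H)
  have h2 : ∀ᵐ y : ℝ, ∀ᵐ x : ℝ, ∀ᵐ h : ℝ, f (y, x + h) - f (y, x) =
      ∫ t in (0 : ℝ)..h, p (y, x + t) := Measure.ae_ae_of_ae_prod h1
  have hR : MeasurableSet {w : (ℝ × ℝ) × ℝ |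
      |(f w.1 - f w.1 ^ 3 / 3) - (f (w.1.1, w.2) - f (w.1.1, w.2) ^ 3 / 3)| ≤ a w.1.1} :=
    measurableSet_le (by fun_prop) (by fun_prop)
  rw [Measure.volume_eq_prod, Measure.ae_prod_iff_ae_ae hR]
  have hR' : MeasurableSet {z : ℝ × ℝ | ∀ᵐ x' : ℝ,
      |(f z - f z ^ 3 / 3) - (f (z.1, x') - f (z.1, x') ^ 3 / 3)| ≤ a z.1} :=
    measurable_measure_prodMk_left hR.compl (measurableSet_singleton 0)
  rw [Measure.volume_eq_prod, Measure.ae_prod_iff_ae_ae hR']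
  filter_upwards [h2, hint.prod_right_ae, hp2.prod_right_ae] with y hy hy1 hy2
  obtain ⟨x₀, hx₀⟩ := hy.exists
  have hpl : LocallyIntegrable fun x => p (y, x) :=
    ((memLp_two_iff_integrable_sq
      (hp.comp measurable_prodMk_left).aestronglyMeasurable).2 hy2).locallyIntegrable (by norm_num)
  exact ae_abs_sub_le_integral_of_primitive hpl hx₀ hy1

/-- The oscillation bound in the first coordinate is the bound in the second one after swapping the
axes. -/
lemma exists_sign_of_integrable_one_sub_sq {f p q : ℝ × ℝ → ℝ} (hf : Measurable f)
    (hp : Measurable p) (hq : Measurable q) (hb : ∀ z, |f z| ≤ 1)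
    (hi : Integrable fun z => 1 - f z ^ 2) (hp2 : Integrable fun z => p z ^ 2)
    (hq2 : Integrable fun z => q z ^ 2)
    (hpf : ∀ h, ∀ᵐ z : ℝ × ℝ, f (z.1, z.2 + h) - f z = ∫ t in (0 : ℝ)..h, p (z.1, z.2 + t))
    (hqf : ∀ h, ∀ᵐ z : ℝ × ℝ, f (z.1 + h, z.2) - f z = ∫ t in (0 : ℝ)..h, q (z.1 + t, z.2)) :
    ∃ s : ℝ, s ^ 2 = 1 ∧ Integrable fun z => 1 - s * f z := by
  have hs : MeasurePreserving (Prod.swap : ℝ × ℝ → ℝ × ℝ) volume volume :=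
    Measure.measurePreserving_swap
  obtain ⟨a, ha, hA⟩ := exists_integrable_oscillation_bound hf hp hb hi hp2 hpf
  obtain ⟨b, hb', hB⟩ := exists_integrable_oscillation_bound (hf.comp measurable_swap)
    (hq.comp measurable_swap) (fun z => hb z.swap) (hs.integrable_comp_of_integrable hi)
    (hs.integrable_comp_of_integrable hq2)
    (fun h => hs.quasiMeasurePreserving.ae (hqf h))
  have hB' := (QuasiMeasurePreserving.prodMap hs.quasiMeasurePreserving
    (Measure.QuasiMeasurePreserving.id (volume : Measure ℝ))).ae hB
  obtain ⟨c, hc⟩ := exists_integrable_sq_sub_const (φ := fun z => f z - f z ^ 3 / 3) (by fun_prop)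
    (M := 2) (fun z => by
      obtain ⟨h1, h2⟩ := abs_le.1 (hb z)
      have h3 : |f z ^ 3| ≤ 1 := by rw [abs_pow]; exact pow_le_one₀ (abs_nonneg _) (hb z)
      obtain ⟨h4, h5⟩ := abs_le.1 h3
      rw [abs_le]; constructor <;> linarith) ha hb' hA hB'
  refine exists_sign_of_integrable_sq ?_ hf hb hi hc
  rw [Measure.volume_eq_prod, ← Set.univ_prod_univ, Measure.prod_prod]
  simp

/-! ### Weak gradients and translations -/

lemma integrable_shear {p : Plane → ℝ} (hp : Integrable p) (e : Plane) (h : ℝ) :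
    Integrable (fun z : ℝ × Plane => p (z.2 + z.1 • e))
      ((volume.restrict (Set.uIoc 0 h)).prod volume) := by
  have : IsFiniteMeasure (volume.restrict (Set.uIoc 0 h)) := ⟨by simp [Set.uIoc]⟩
  have hm : MeasurePreserving (fun z : ℝ × Plane => (id z.1, z.2 + z.1 • e))
      ((volume.restrict (Set.uIoc 0 h)).prod volume)
      ((volume.restrict (Set.uIoc 0 h)).prod volume) :=
    (MeasurePreserving.id _).skew_product (g := fun t y => y + t • e) (by fun_prop)
      (Eventually.of_forall fun t => (measurePreserving_add_right volume (t • e)).map_eq)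
  exact hm.integrable_comp_of_integrable (hp.comp_snd (volume.restrict (Set.uIoc 0 h)))

/-- A function with a weak gradient is, for every translation along a coordinate direction, the
primitive of its weak partial derivative. -/
lemma HasWeakGradient.ae_sub_eq_integral {v : Plane → ℝ} {G : Plane → Plane}
    (hv : HasWeakGradient v G) (i : Fin 2) (h : ℝ) :
    ∀ᵐ x, v (x + h • EuclideanSpace.single i 1) - v x =
      ∫ t in (0 : ℝ)..h, G (x + t • EuclideanSpace.single i 1) i := by
  set e : Plane := EuclideanSpace.single i 1 with he
  have he1 : ‖e‖ = 1 := by simp [he]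
  have hp : LocallyIntegrable fun x => G x i := fun x => by
    obtain ⟨s, hs, h⟩ := hv.locallyIntegrable_gradient x
    exact ⟨s, hs, (EuclideanSpace.proj (𝕜 := ℝ) i : Plane →L[ℝ] ℝ).integrable_comp h⟩
  have htr (w : Plane) (f : Plane → ℝ) (hf : LocallyIntegrable f) :
      LocallyIntegrable fun x => f (x + w) := by
    rw [locallyIntegrable_iff]
    intro K hK
    have h1 := hf.integrableOn_isCompact (hK.image (continuous_add_const w))
    have h2 := (measurePreserving_add_right volume w).integrableOn_comp_preimage
      (measurableEmbedding_addRight w) (f := f) (s := (fun x => x + w) '' K)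
    rw [Set.preimage_image_eq _ (add_left_injective w)] at h2
    exact h2.2 h1
  -- Truncation makes the partial derivative globally integrable, as Fubini needs. The radius R +
  -- |h| keeps every translate of the R-ball inside.
  let P (R : ℝ) : Plane → ℝ := (Metric.closedBall 0 (R + |h|)).indicator fun x => G x i
  have hP (R : ℝ) : Integrable (P R) := by
    rw [integrable_indicator_iff measurableSet_closedBall]
    exact hp.integrableOn_isCompact (isCompact_closedBall _ _)
  have hPe {R : ℝ} {x : Plane} (hx : ‖x‖ ≤ R) {t : ℝ} (ht : t ∈ Set.uIoc 0 h) :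
      P R (x + t • e) = G (x + t • e) i := by
    apply Set.indicator_of_mem
    rw [mem_closedBall_zero_iff]
    refine (norm_add_le _ _).trans (add_le_add hx ?_)
    rw [norm_smul, he1, mul_one, Real.norm_eq_abs]
    have := Set.abs_sub_left_of_mem_uIcc (Set.uIoc_subset_uIcc ht)
    simpa using this
  have hloc : LocallyIntegrable fun x => ∫ t in (0 : ℝ)..h, G (x + t • e) i := by
    rw [locallyIntegrable_iff]
    intro K hK
    obtain ⟨R, hR⟩ := hK.isBounded.exists_norm_le
    have h1 := (integrable_shear (hP R) e h).integral_prod_right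
    simp_rw [intervalIntegral.intervalIntegral_eq_integral_uIoc]
    have h2 : IntegrableOn (fun x => ∫ t in Set.uIoc 0 h, G (x + t • e) i) K :=
      h1.integrableOn.congr_fun (fun x hx =>
        setIntegral_congr_fun measurableSet_uIoc fun t ht => hPe (hR x hx) ht) hK.measurableSet
    exact Integrable.smul (if (0 : ℝ) ≤ h then (1 : ℝ) else -1) h2
  refine ae_eq_of_integral_contDiff_smul_eq ((htr _ v hv.locallyIntegrable).sub
    hv.locallyIntegrable) hloc fun φ hφ hφc => ?_
  have hvφ (t : ℝ) : Integrable fun x => φ x * v (x + t • e) :=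
    (htr _ v hv.locallyIntegrable).integrable_smul_left_of_hasCompactSupport hφ.continuous hφc
  -- With the reflected test function, convolution at t e is the pairing of φ with the translate by
  -- t e. Differentiating in t and using the weak gradient then gives an ordinary primitive.
  let ψ : Plane → ℝ := fun x => φ (-x)
  have hψ : ContDiff ℝ ∞ ψ := hφ.comp contDiff_neg
  have hψc : HasCompactSupport ψ := hφc.comp_homeomorph (Homeomorph.neg Plane)
  have hconv (f : Plane → ℝ) (t : ℝ) :
      convolution f ψ (ContinuousLinearMap.mul ℝ ℝ) volume (t • e) =
        ∫ x, φ x * f (x + t • e) := by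
    rw [convolution_def, ← integral_add_right_eq_self _ (t • e)]
    congr 1
    ext x
    simp only [ContinuousLinearMap.mul_apply', ψ]
    rw [mul_comm]
    congr 2
    abel
  have hder (t : ℝ) : HasDerivAt
      (fun t : ℝ => convolution v ψ (ContinuousLinearMap.mul ℝ ℝ) volume (t • e))
      (convolution (fun x => G x i) ψ (ContinuousLinearMap.mul ℝ ℝ) volume (t • e)) t := by
    have h1 := hψc.hasFDerivAt_convolution_right (ContinuousLinearMap.mul ℝ ℝ)
      hv.locallyIntegrable (hψ.of_le (by simp)) (t • e)
    have h2 : HasDerivAt (fun t : ℝ => t • e) e t := by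
      simpa using (hasDerivAt_id t).smul_const e
    refine (h1.comp_hasDerivAt t h2).congr_deriv ?_
    rw [convolution_precompR_apply _ hv.locallyIntegrable (hψc.fderiv ℝ)
      (hψ.continuous_fderiv (by simp)), convolution_def, convolution_def]
    simp only [ContinuousLinearMap.mul_apply']
    have h3 : ContDiff ℝ ∞ fun x => ψ (t • e - x) := hψ.comp (contDiff_const.sub contDiff_id)
    have h4 : HasCompactSupport fun x => ψ (t • e - x) :=
      hψc.comp_homeomorph (Homeomorph.subLeft (t • e))
    have h5 := hv.integral_eq _ h3 h4 i
    have h6 (x : Plane) : fderiv ℝ (fun x => ψ (t • e - x)) x = - fderiv ℝ ψ (t • e - x) := by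
      have h7 : HasFDerivAt (fun x => t • e - x) (-ContinuousLinearMap.id ℝ Plane) x :=
        (hasFDerivAt_id x).const_sub _
      have h8 := ((hψ.differentiable (by simp)).differentiableAt (x := t • e - x)).hasFDerivAt
      have h9 : HasFDerivAt (fun x => ψ (t • e - x)) _ x := h8.comp x h7
      rw [h9.fderiv]
      ext y
      simp
    simp_rw [h6] at h5
    simp only [neg_apply, mul_neg, integral_neg, neg_inj] at h5
    exact h5
  have hcont : Continuous fun t : ℝ =>
      convolution (fun x => G x i) ψ (ContinuousLinearMap.mul ℝ ℝ) volume (t • e) :=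
    (hψc.continuous_convolution_right _ hp hψ.continuous).comp (by fun_prop)
  have hftc := intervalIntegral.integral_eq_sub_of_hasDerivAt (fun t _ => hder t)
    (hcont.intervalIntegrable 0 h)
  simp_rw [hconv] at hftc
  obtain ⟨R, hR⟩ := hφc.isCompact.isBounded.exists_norm_le
  have hswap : ∫ t in (0 : ℝ)..h, ∫ x, φ x * G (x + t • e) i =
      ∫ x, ∫ t in (0 : ℝ)..h, φ x * G (x + t • e) i := by
    apply intervalIntegral_integral_swap
    obtain ⟨M, hM⟩ := hφ.continuous.bounded_above_of_compact_support hφc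
    have h1 : Integrable (fun z : ℝ × Plane => φ z.2 * P R (z.2 + z.1 • e))
        ((volume.restrict (Set.uIoc 0 h)).prod volume) :=
      (integrable_shear (hP R) e h).bdd_mul (c := M)
        (hφ.continuous.comp continuous_snd).aestronglyMeasurable
        (Eventually.of_forall fun z => hM z.2)
    refine h1.congr ?_
    have h2 : ∀ᵐ z : ℝ × Plane ∂(volume.restrict (Set.uIoc 0 h)).prod volume,
        z.1 ∈ Set.uIoc 0 h :=
      Measure.quasiMeasurePreserving_fst.ae (ae_restrict_mem measurableSet_uIoc)
    filter_upwards [h2] with z hz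
    simp only [Function.uncurry]
    by_cases hx : z.2 ∈ tsupport φ
    · rw [hPe (hR _ hx) hz]
    · rw [image_eq_zero_of_notMem_tsupport hx, zero_mul, zero_mul]
  rw [hswap] at hftc
  simp only [smul_eq_mul, mul_sub]
  rw [integral_sub (hvφ h) (by simpa using hvφ 0)]
  simp only [zero_smul, add_zero] at hftc
  rw [← hftc]
  simp only [intervalIntegral.integral_const_mul]

lemma HasWeakGradient.congr {v v' : Plane → ℝ} {G G' : Plane → Plane} (h : HasWeakGradient v G)
    (hv : v =ᵐ[volume] v') (hG : G =ᵐ[volume] G') : HasWeakGradient v' G' where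
  locallyIntegrable := h.locallyIntegrable.congr hv
  locallyIntegrable_gradient := h.locallyIntegrable_gradient.congr hG
  integral_eq φ hφ hφc i := by
    have h1 : ∫ x, v x * fderiv ℝ φ x (EuclideanSpace.single i 1) =
        ∫ x, v' x * fderiv ℝ φ x (EuclideanSpace.single i 1) :=
      integral_congr_ae (hv.mono fun x hx => by simp only [hx])
    have h2 : ∫ x, G x i * φ x = ∫ x, G' x i * φ x :=
      integral_congr_ae (hG.mono fun x hx => by simp only [hx])
    rw [← h1, ← h2, h.integral_eq φ hφ hφc i]

/-- The identification of `ℝ × ℝ` with the plane. -/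
def planeEquiv : ℝ × ℝ ≃ᵐ Plane :=
  MeasurableEquiv.finTwoArrow.symm.trans (MeasurableEquiv.toLp 2 (Fin 2 → ℝ))

lemma measurePreserving_planeEquiv : MeasurePreserving planeEquiv :=
  (PiLp.volume_preserving_toLp (Fin 2)).comp (volume_preserving_finTwoArrow ℝ).symm

lemma planeEquiv_add_snd (z : ℝ × ℝ) (h : ℝ) :
    planeEquiv (z.1, z.2 + h) = planeEquiv z + h • EuclideanSpace.single 1 1 := by
  ext i
  fin_cases i <;> simp [planeEquiv]

lemma planeEquiv_add_fst (z : ℝ × ℝ) (h : ℝ) :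
    planeEquiv (z.1 + h, z.2) = planeEquiv z + h • EuclideanSpace.single 0 1 := by
  ext i
  fin_cases i <;> simp [planeEquiv]

/-- A function on the plane with values in `[-1, 1]`, square integrable gradient and integrable
`1 - v²` tends in the mean to one of the values `±1` at infinity. -/
theorem HasWeakGradient.exists_sign {v : Plane → ℝ} {G : Plane → Plane} (hv : HasWeakGradient v G)
    (hG : MemLp G 2) (hb : ∀ᵐ x, |v x| ≤ 1) (hi : Integrable fun x => 1 - v x ^ 2) :
    ∃ s : ℝ, s ^ 2 = 1 ∧ Integrable fun x => 1 - s * v x := by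
  have hvm := hv.locallyIntegrable.aestronglyMeasurable
  have hE := measurePreserving_planeEquiv
  -- A measurable representative, truncated so that the bound holds everywhere and not just almost
  -- everywhere.
  set v' : Plane → ℝ := fun x => max (-1) (min 1 (hvm.mk v x)) with hv'
  have hv'm : Measurable v' := measurable_const.max (measurable_const.min
    hvm.stronglyMeasurable_mk.measurable)
  have hvv : v =ᵐ[volume] v' := by
    filter_upwards [hvm.ae_eq_mk, hb] with x hx hx'
    obtain ⟨h1, h2⟩ := abs_le.1 hx'
    simp only [hv', ← hx]
    rw [min_eq_right h2, max_eq_right h1]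
  set G' := hG.aestronglyMeasurable.mk G with hG'
  have hGm : Measurable G' := hG.aestronglyMeasurable.stronglyMeasurable_mk.measurable
  have hGG : G =ᵐ[volume] G' := hG.aestronglyMeasurable.ae_eq_mk
  have hw := hv.congr hvv hGG
  have hGL : MemLp G' 2 := hG.ae_eq hGG
  have hG2 (i : Fin 2) : Integrable fun x => G' x i ^ 2 :=
    ((EuclideanSpace.proj (𝕜 := ℝ) i : Plane →L[ℝ] ℝ).comp_memLp' hGL).integrable_sq
  have hGim (i : Fin 2) : Measurable fun x => G' x i :=
    (EuclideanSpace.proj (𝕜 := ℝ) i : Plane →L[ℝ] ℝ).continuous.measurable.comp hGm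
  have hi' : Integrable fun x => 1 - v' x ^ 2 := hi.congr (by
    filter_upwards [hvv] with x hx
    rw [hx])
  obtain ⟨s, hs, h⟩ := exists_sign_of_integrable_one_sub_sq (f := v' ∘ planeEquiv)
    (p := fun z => G' (planeEquiv z) 1) (q := fun z => G' (planeEquiv z) 0)
    (hv'm.comp planeEquiv.measurable) ((hGim 1).comp planeEquiv.measurable)
    ((hGim 0).comp planeEquiv.measurable)
    (fun z => abs_le.2 ⟨le_max_left _ _, max_le (by norm_num) (min_le_left _ _)⟩)
    (hE.integrable_comp_of_integrable hi') (hE.integrable_comp_of_integrable (hG2 1))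
    (hE.integrable_comp_of_integrable (hG2 0))
    (fun h => by
      simpa only [Function.comp, planeEquiv_add_snd] using
        hE.quasiMeasurePreserving.ae (hw.ae_sub_eq_integral 1 h))
    (fun h => by
      simpa only [Function.comp, planeEquiv_add_fst] using
        hE.quasiMeasurePreserving.ae (hw.ae_sub_eq_integral 0 h))
  refine ⟨s, hs, ?_⟩
  have h2 : Integrable fun x => 1 - s * v' x :=
    (hE.integrable_comp_emb planeEquiv.measurableEmbedding).1 h
  refine h2.congr ?_
  filter_upwards [hvv] with x hx
  rw [hx]

/-! ### The Lebesgue point at the north pole -/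

lemma norm_sq_sub_single {w : Space} (hw : ‖w‖ = 1) {s : ℝ} (hs : s ^ 2 = 1) :
    ‖w - EuclideanSpace.single 2 s‖ ^ 2 = 2 * (1 - s * w 2) := by
  rw [norm_sub_sq_real, hw, PiLp.norm_single, Real.norm_eq_abs, sq_abs, hs, inner_space]
  simp
  ring

/-- The third coordinate of Φ is 1 - λ, so the squared distance to the pole is 2λ. -/
lemma conformalFactor_lt_of_mem_ball {x : Plane} {r : ℝ}
    (hx : invStereo x ∈ Metric.ball northPole r) : conformalFactor x < r ^ 2 / 2 := by
  rw [Metric.mem_ball, Subtype.dist_eq, dist_eq_norm] at hx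
  have h1 := norm_sq_sub_single (norm_invStereoVal x) (one_pow 2)
  have h2 : ‖invStereoVal x - EuclideanSpace.single 2 1‖ ^ 2 < r ^ 2 :=
    pow_lt_pow_left₀ hx (norm_nonneg _) two_ne_zero
  rw [h1, invStereoVal_eq] at h2
  simp at h2
  linarith

/-- The true order is r², but the weaker r³ suffices because the squared deviation integrates to
O(r⁴). -/
lemma exists_surface_ball_ge : ∃ c : ℝ, 0 < c ∧ ∀ r, 0 < r → r ≤ 2 →
    c * r ^ 3 ≤ surface.real (Metric.ball northPole r) := by
  have hpos : 0 < (volume : Measure Space).real (Metric.ball 0 1) :=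
    ENNReal.toReal_pos (Metric.measure_ball_pos _ _ one_pos).ne' measure_ball_lt_top.ne
  refine ⟨3 / 64 * (volume : Measure Space).real (Metric.ball 0 1), by positivity, fun r h0 h2 => ?_⟩
  refine le_trans (le_of_eq ?_)
    (Measure.toSphereBallBound_mul_measureReal_unitBall_le_toSphere_ball volume h0 northPole)
  rw [Measure.toSphereBallBound, if_pos ⟨by simp, h0⟩]
  have : Real.toNNReal r ≤ 2 := by simpa using h2
  rw [min_eq_left this]
  simp [h0.le]
  ring

/-- Integrability of `1 - s m₃` in the plane forces `s e₃` to be the Lebesgue value at the pole. -/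
theorem isLebesguePoint_northPole {m : Plane → Space} (hmeas : AEStronglyMeasurable m)
    (hm : ∀ᵐ x, ‖m x‖ = 1) {s : ℝ} (hs : s ^ 2 = 1) (hint : Integrable fun x => 1 - s * m x 2) :
    IsLebesguePoint (fun ξ => m (stereo ξ)) northPole := by
  have hwm : AEStronglyMeasurable (fun ξ => m (stereo ξ)) surface := by
    apply aestronglyMeasurable_surface
    simpa only [Function.comp_def, stereo_invStereo] using hmeas
  have hw1 : ∀ᵐ ξ ∂surface, ‖m (stereo ξ)‖ = 1 := ae_surface_stereo hm
  have hwi : Integrable (fun ξ => m (stereo ξ)) surface :=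
    Integrable.of_bound hwm 1 (hw1.mono fun ξ h => h.le)
  refine ⟨hwi.integrableAtFilter _, EuclideanSpace.single 2 s, ?_⟩
  set a : Space := EuclideanSpace.single 2 s with ha
  have hd : Integrable (fun ξ => ‖m (stereo ξ) - a‖) surface := (hwi.sub (integrable_const a)).norm
  have hd2 : Integrable (fun ξ => ‖m (stereo ξ) - a‖ ^ 2) surface := by
    refine Integrable.of_bound (hd.aestronglyMeasurable.pow 2) ((1 + ‖a‖) ^ 2) ?_
    filter_upwards [hw1] with ξ hξ
    rw [Real.norm_of_nonneg (sq_nonneg _)]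
    exact pow_le_pow_left₀ (norm_nonneg _) ((norm_sub_le _ _).trans_eq (by rw [hξ])) 2
  have hnn : ∀ᵐ x, 0 ≤ 1 - s * m x 2 := by
    filter_upwards [hm] with x hx
    have := norm_sq_sub_single hx hs
    nlinarith [sq_nonneg ‖m x - EuclideanSpace.single 2 s‖]
  set K : ℝ := ∫ x, (1 - s * m x 2) with hK
  have hK0 : 0 ≤ K := integral_nonneg_of_ae hnn
  -- On the ball λ² ≤ r⁴ / 4, while |m - a|² = 2 (1 - s m₃).
  have hsq (r : ℝ) : ∫ ξ in Metric.ball northPole r, ‖m (stereo ξ) - a‖ ^ 2 ∂surface ≤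
      K / 2 * r ^ 4 := by
    rw [← integral_indicator measurableSet_ball, integral_surface]
    have h1 : K / 2 * r ^ 4 = ∫ x, r ^ 4 / 2 * (1 - s * m x 2) := by
      rw [integral_const_mul, ← hK]; ring
    rw [h1]
    refine integral_mono_ae ((integrable_surface_iff _).1 (hd2.indicator measurableSet_ball))
      (hint.const_mul _) ?_
    filter_upwards [hm, hnn] with x hx hx0
    by_cases hb : invStereo x ∈ Metric.ball northPole r
    · have h2 := conformalFactor_lt_of_mem_ball hb
      have h3 := pow_le_pow_left₀ (conformalFactor_pos x).le h2.le 2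
      simp only [Set.indicator_of_mem hb, stereo_invStereo, smul_eq_mul, ha,
        norm_sq_sub_single hx hs]
      nlinarith
    · simp only [Set.indicator_of_notMem hb, smul_zero]
      positivity
  obtain ⟨c, hc, hball⟩ := exists_surface_ball_ge
  have hbound : ∀ᶠ r : ℝ in 𝓝[>] 0, ⨍ ξ in Metric.ball northPole r, ‖m (stereo ξ) - a‖ ∂surface ≤
      (1 + K / (2 * c)) * √r := by
    filter_upwards [Ioo_mem_nhdsGT (show (0 : ℝ) < 2 by norm_num)] with r hr
    have hr0 : 0 < r := hr.1
    have hσ := hball r hr0 hr.2.le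
    have hσ0 : 0 < surface.real (Metric.ball northPole r) := lt_of_lt_of_le (by positivity) hσ
    have hq : 0 < √r := Real.sqrt_pos.2 hr0
    have hqq : √r * √r = r := Real.mul_self_sqrt hr0.le
    -- Young's inequality t ≤ √r + t² / √r. After division by the area the second term is at most of
    -- order r⁴ / (√r r³) = √r, so both terms balance.
    have h1 : ∫ ξ in Metric.ball northPole r, ‖m (stereo ξ) - a‖ ∂surface ≤
        ∫ ξ in Metric.ball northPole r, (√r + (√r)⁻¹ * ‖m (stereo ξ) - a‖ ^ 2) ∂surface := by
      refine integral_mono hd.integrableOn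
        ((integrable_const _).add (hd2.integrableOn.const_mul _)) fun ξ => ?_
      set t := ‖m (stereo ξ) - a‖
      have ht : 0 ≤ t := norm_nonneg _
      have h2 : √r + (√r)⁻¹ * t ^ 2 - t = (√r)⁻¹ * ((√r - t / 2) ^ 2 + 3 / 4 * t ^ 2) := by
        field_simp; ring
      have h3 : 0 ≤ (√r)⁻¹ * ((√r - t / 2) ^ 2 + 3 / 4 * t ^ 2) := by positivity
      simp only
      linarith
    rw [integral_add (integrable_const _) (hd2.integrableOn.const_mul _), integral_const_mul,
      setIntegral_const, smul_eq_mul] at h1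
    rw [setAverage_eq, smul_eq_mul, inv_mul_le_iff₀ hσ0]
    have h4 : (√r)⁻¹ * ∫ ξ in Metric.ball northPole r, ‖m (stereo ξ) - a‖ ^ 2 ∂surface ≤
        (√r)⁻¹ * (K / 2 * r ^ 4) := mul_le_mul_of_nonneg_left (hsq r) (by positivity)
    have h5 : (√r)⁻¹ * (K / 2 * r ^ 4) = K / (2 * c) * √r * (c * r ^ 3) := by
      have : r ^ 4 = r ^ 3 * (√r * √r) := by rw [hqq]; ring
      rw [this]
      field_simp
    have h6 : K / (2 * c) * √r * (c * r ^ 3) ≤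
        K / (2 * c) * √r * surface.real (Metric.ball northPole r) :=
      mul_le_mul_of_nonneg_left hσ (by positivity)
    linarith
  have hlim : Tendsto (fun r : ℝ => (1 + K / (2 * c)) * √r) (𝓝[>] 0) (𝓝 0) := by
    have : Tendsto (fun r : ℝ => (1 + K / (2 * c)) * √r) (𝓝 0) (𝓝 ((1 + K / (2 * c)) * √0)) :=
      (Continuous.tendsto (by fun_prop) 0)
    rw [Real.sqrt_zero, mul_zero] at this
    exact this.mono_left nhdsWithin_le_nhds
  refine squeeze_zero' (Eventually.of_forall fun r => ?_) hbound hlim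
  rw [setAverage_eq]
  exact smul_nonneg (by positivity) (integral_nonneg fun ξ => norm_nonneg _)

end

end LebesguePointAtInfinity

open LebesguePointAtInfinity in
theorem corollaryA3 (m : Plane → Space) (hm : MemHomSobolevSphere m)
    (hint : Integrable (fun x => 1 - m x 2 ^ 2) ∨ Integrable (fun x => 1 - m x 2)) :
    MemSobolevSphere (fun ξ => m (stereo ξ)) ∧
      IsLebesguePoint (fun ξ => m (stereo ξ)) northPole := by
  refine ⟨memSobolevSphere_comp_stereo hm, ?_⟩
  have hmeas : AEStronglyMeasurable m := by
    have h1 : AEMeasurable fun x => WithLp.ofLp (m x) :=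
      aemeasurable_pi_lambda _ fun i => by
        obtain ⟨G, hG, -⟩ := hm.1 i
        exact hG.locallyIntegrable.aestronglyMeasurable.aemeasurable
    exact ((MeasurableEquiv.toLp 2 (Fin 3 → ℝ)).measurable.comp_aemeasurable
      h1).aestronglyMeasurable
  obtain ⟨s, hs, h⟩ : ∃ s : ℝ, s ^ 2 = 1 ∧ Integrable fun x => 1 - s * m x 2 := by
    -- Integrability of 1 - m₃ is already the case s = 1; only the other hypothesis leaves the sign
    -- to be determined.
    rcases hint with h | h
    · obtain ⟨G, hG, hG2⟩ := hm.1 2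
      refine hG.exists_sign hG2 ?_ h
      filter_upwards [hm.2] with x hx
      rw [← hx]
      exact PiLp.norm_apply_le (m x) 2
    · exact ⟨1, one_pow 2, by simpa using h⟩
  exact isLebesguePoint_northPole hmeas hm.2 hs h
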